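/- Let $X$ be a compact (Hausdorff) complex manifold of dimension $n$ with complex structure $J$ and a smooth Hermitian metric $g$. In local holomorphic coordinates write $g_{i\bar j}=g(\partial_i,\partial_{\bar j})$, let $g^{j\bar m}$ be the inverse, $g^{j\bar m}g_{k\bar m}=\delta^j_k$, and write $$\Gamma_{ki}^j=g^{j\bar m}\partial_k g_{i\bar m},\qquad T_{ij}^k=\Gamma_{ij}^k-\Gamma_{ji}^k,\qquad T_{ij\bar k}=T_{ij}^l g_{l\bar k},\qquad R_{i\bar jk\bar l}=-(\partial_{\bar j}\Gamma_{ik}^m)\,g_{m\bar l}$$ for the coefficients, torsion and curvature of the Chern connection, and put $$Q_{i\bar jk\bar l}=R_{i\bar jk\bar l}-g^{p\bar q}\,T_{kp\bar j}\,\overline{T_{lq\bar i}} .$$ Suppose that $(X,J,g)$ is $Q$-nonnegative: at every point, in every frame of $T^{1,0}X$ with $g_{i\bar j}=\delta_{ij}$, and for all real numbers $\lambda_1,\dots,\lambda_n$, $$\sum_{k,m=1}^n Q_{m\bar mk\bar k}\,(\lambda_k^2-\lambda_k\lambda_m)\ \ge\ 0 .$$ Let $\rho=\sqrt{-1}\,\rho_{k\bar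 j}\,dz^k\wedge d\bar z^j$ be a smooth real $(1,1)$-form on $X$ with $d\rho=0$ whose trace $g^{i\bar j}\rho_{i\bar j}$ is constant. Then: 1. $\rho$ is parallel with respect to the Bismut connection, that is, $\nabla^+\rho=0$, where $\nabla^+$ is the connection on $T^{1,0}X$ given in local holomorphic coordinates by $$\nabla^+_iX^j=\partial_iX^j+\Gamma_{li}^jX^l,\qquad \nabla^+_{\bar i}X^j=\partial_{\bar i}X^j+g^{j\bar m}\,\overline{T_{im\bar l}}\,X^l .$$ 2. If $x\in X$ and $U,V,W\in T^{1,0}_xX$ lie in the eigenspaces, for real numbers $\lambda_U,\lambda_V,\lambda_W$ respectively, of the endomorphism $U\mapsto g^{j\bar m}\rho_{i\bar m}U^i\,\partial_j$ of $T^{1,0}_xX$ determined by $\rho$ and $g$, and if $\lambda_U+\lambda_V-\lambda_W\ne 0$, then the Chern torsion satisfies $$T(U,V,\overline W)=T_{ij\bar k}\,U^iV^j\,\overline{W^k}=0 .$$ -/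

import Mathlib

open scoped Manifold ContDiff

noncomputable section

namespace HermitianGeometry

/-- The model space `ℂⁿ` of an `n`-dimensional complex manifold. -/
abbrev Cn (n : ℕ) : Type := EuclideanSpace ℂ (Fin n)

/-- The tangent space at `x` of a complex manifold.  It is a complex vector space, and the almost
complex structure `J` is multiplication by `Complex.I`. -/
abbrev Tan (n : ℕ) {X : Type*} [TopologicalSpace X] [ChartedSpace (Cn n) X] (x : X) : Type :=
  TangentSpace 𝓘(ℂ, Cn n) x

/-- All holomorphic coordinate charts: the maximal holomorphic atlas. -/
abbrev holCharts (n : ℕ) (X : Type*) [TopologicalSpace X] [ChartedSpace (Cn n) X] :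
    Set (OpenPartialHomeomorph X (Cn n)) :=
  IsManifold.maximalAtlas 𝓘(ℂ, Cn n) ω X

/-- The differential at `y` of the inverse `ℂⁿ → X` of a holomorphic chart. -/
def dSymm {n : ℕ} {X : Type*} [TopologicalSpace X] [ChartedSpace (Cn n) X]
    (e : OpenPartialHomeomorph X (Cn n)) (y : Cn n) : Cn n →L[ℂ] Tan n (e.symm y) :=
  mfderiv 𝓘(ℂ, Cn n) 𝓘(ℂ, Cn n) e.symm y

/-- The `i`-th standard basis vector of `ℂⁿ`, i.e. the real coordinate vector `∂/∂xⁱ`;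
`Complex.I • stdVec i` is `∂/∂yⁱ`, where `zⁱ = xⁱ + √-1 yⁱ`. -/
def stdVec {n : ℕ} (i : Fin n) : Cn n := EuclideanSpace.single i 1

/-- The value `B(u¹⁰, v⁰¹)` of the complex bilinear extension of a real bilinear form `B` on a
complex vector space, where `u¹⁰ = (u - √-1 J u) / 2` and `v⁰¹ = (v + √-1 J v) / 2`.
For `u = ∂/∂xⁱ`, `v = ∂/∂xʲ` these are `∂/∂zⁱ` and `∂/∂z̄ʲ`. -/
def mixed {V : Type*} [AddCommGroup V] [Module ℂ V] (B : V → V → ℝ) (u v : V) : ℂ :=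
  (1 / 4 : ℂ) * (((B u v + B (Complex.I • u) (Complex.I • v) : ℝ) : ℂ)
    + Complex.I * ((B u (Complex.I • v) - B (Complex.I • u) v : ℝ) : ℂ))

/-- The Wirtinger derivative `∂f/∂zⁱ`. -/
def dz {n : ℕ} (i : Fin n) (f : Cn n → ℂ) (y : Cn n) : ℂ :=
  (1 / 2 : ℂ) * (fderiv ℝ f y (stdVec i) - Complex.I * fderiv ℝ f y (Complex.I • stdVec i))

/-- The Wirtinger derivative `∂f/∂z̄ⁱ`. -/
def dzbar {n : ℕ} (i : Fin n) (f : Cn n → ℂ) (y : Cn n) : ℂ :=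
  (1 / 2 : ℂ) * (fderiv ℝ f y (stdVec i) + Complex.I * fderiv ℝ f y (Complex.I • stdVec i))

/-- A smooth Hermitian metric on a complex manifold: a smooth Riemannian metric for which
`J` is an isometry. -/
structure HermitianMetric (n : ℕ) (X : Type*) [TopologicalSpace X] [ChartedSpace (Cn n) X] where
  /-- the metric on each tangent space -/
  val : ∀ x : X, Tan n x →ₗ[ℝ] Tan n x →ₗ[ℝ] ℝ
  symm : ∀ (x : X) (u v : Tan n x), val x u v = val x v u
  pos : ∀ (x : X) (u : Tan n x), u ≠ 0 → 0 < val x u u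
  compat : ∀ (x : X) (u v : Tan n x), val x (Complex.I • u) (Complex.I • v) = val x u v
  smooth : ∀ e ∈ holCharts n X, ∀ u v : Cn n,
    ContDiffOn ℝ ∞ (fun y => val (e.symm y) (dSymm e y u) (dSymm e y v)) e.target

/-- A real two-form, not necessarily continuous, written in a holomorphic chart (the pull-back by
the inverse of the chart). -/
def chartForm {n : ℕ} {X : Type*} [TopologicalSpace X] [ChartedSpace (Cn n) X]
    (ρ : ∀ x : X, Tan n x [⋀^Fin 2]→L[ℝ] ℝ)
    (e : OpenPartialHomeomorph X (Cn n)) (y : Cn n) : Cn n [⋀^Fin 2]→L[ℝ] ℝ :=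
  (ρ (e.symm y)).compContinuousLinearMap ((dSymm e y).restrictScalars ℝ)

/-- A smooth real `(1,1)`-form: a smooth real two-form `ρ` with `ρ(Ju, Jv) = ρ(u, v)`. -/
structure RealOneOneForm (n : ℕ) (X : Type*) [TopologicalSpace X] [ChartedSpace (Cn n) X] where
  /-- the alternating form on each tangent space -/
  val : ∀ x : X, Tan n x [⋀^Fin 2]→L[ℝ] ℝ
  type_one_one : ∀ (x : X) (u v : Tan n x),
    val x ![Complex.I • u, Complex.I • v] = val x ![u, v]
  smooth : ∀ e ∈ holCharts n X, ContDiffOn ℝ ∞ (chartForm val e) e.target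

section

variable {n : ℕ} {X : Type*} [TopologicalSpace X] [ChartedSpace (Cn n) X]

/-- `dρ = 0`. -/
def RealOneOneForm.Closed (ρ : RealOneOneForm n X) : Prop :=
  ∀ e ∈ holCharts n X, ∀ y ∈ e.target, extDeriv (chartForm ρ.val e) y = 0

/-- The components `ρ_{k j̄}` in a chart, where `ρ = √-1 ρ_{k j̄} dzᵏ ∧ dz̄ʲ`; equivalently
`ρ(∂/∂zᵏ, ∂/∂z̄ʲ) = √-1 ρ_{k j̄}`. -/
def RealOneOneForm.comp (ρ : RealOneOneForm n X) (e : OpenPartialHomeomorph X (Cn n))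
    (k j : Fin n) (y : Cn n) : ℂ :=
  -Complex.I * mixed (fun u v => ρ.val (e.symm y) ![u, v])
    (dSymm e y (stdVec k)) (dSymm e y (stdVec j))

namespace HermitianMetric

variable (g : HermitianMetric n X) (e : OpenPartialHomeomorph X (Cn n))

/-- The components `g_{i j̄} = g(∂/∂zⁱ, ∂/∂z̄ʲ)` in a chart. -/
def comp (i j : Fin n) (y : Cn n) : ℂ :=
  mixed (fun u v => g.val (e.symm y) u v) (dSymm e y (stdVec i)) (dSymm e y (stdVec j))

/-- The inverse metric `g^{i j̄}`, with `∑ₘ g^{j m̄} g_{k m̄} = δʲₖ`. -/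
def inv (i j : Fin n) (y : Cn n) : ℂ :=
  (Matrix.of fun a b => g.comp e a b y)⁻¹ j i

/-- Coefficients of the Chern connection: `Γ_{ki}^j = g^{j m̄} ∂ₖ g_{i m̄}`, so that
`∇ₖ Xʲ = ∂ₖ Xʲ + Γ_{ki}^j Xⁱ` and `∇_{k̄} Xʲ = ∂_{k̄} Xʲ`. -/
def Gam (k i j : Fin n) (y : Cn n) : ℂ :=
  ∑ m, g.inv e j m y * dz k (g.comp e i m) y

/-- The Chern torsion `T_{ij}^k = Γ_{ij}^k - Γ_{ji}^k`. -/
def torsion (i j k : Fin n) (y : Cn n) : ℂ := g.Gam e i j k y - g.Gam e j i k y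

/-- The Chern torsion with lowered index, `T_{ij k̄} = T_{ij}^l g_{l k̄}`. -/
def torsionLow (i j k : Fin n) (y : Cn n) : ℂ := ∑ l, g.torsion e i j l y * g.comp e l k y

/-- The Chern curvature `R_{i j̄ k}^l = -∂_{j̄} Γ_{ik}^l`. -/
def curv (i j k l : Fin n) (y : Cn n) : ℂ := -dzbar j (g.Gam e i k l) y

/-- The Chern curvature with lowered index, `R_{i j̄ k l̄} = R_{i j̄ k}^m g_{m l̄}`. -/
def curvLow (i j k l : Fin n) (y : Cn n) : ℂ := ∑ m, g.curv e i j k m y * g.comp e m l y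

/-- The tensor
`Q_{i j̄ k l̄} = R_{i j̄ k l̄} - g^{p q̄} T_{kp j̄} conj(T_{lq ī})`. -/
def Q (i j k l : Fin n) (y : Cn n) : ℂ :=
  g.curvLow e i j k l y
    - ∑ p, ∑ q, g.inv e p q y * g.torsionLow e k p j y * star (g.torsionLow e l q i y)

/-- `Q(u, v̄, w, z̄)` for `(1,0)`-vectors `u = uⁱ ∂/∂zⁱ` and so on. -/
def QEval (y : Cn n) (u v w z : Fin n → ℂ) : ℂ :=
  ∑ i, ∑ j, ∑ k, ∑ l, g.Q e i j k l y * u i * star (v j) * w k * star (z l)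

/-- `T(u, v, w̄)` for `(1,0)`-vectors `u = uⁱ ∂/∂zⁱ` and so on. -/
def torsionEval (y : Cn n) (u v w : Fin n → ℂ) : ℂ :=
  ∑ i, ∑ j, ∑ k, g.torsionLow e i j k y * u i * v j * star (w k)

/-- `u₁, …, uₙ` is an orthonormal frame of `(1,0)`-vectors: `g(uₐ, ū_b) = δ_{ab}`. -/
def IsUnitaryFrame (y : Cn n) (u : Fin n → Fin n → ℂ) : Prop :=
  ∀ a b, ∑ i, ∑ j, g.comp e i j y * u a i * star (u b j) = if a = b then 1 else 0

/-- `Q`-nonnegativity: in every orthonormal frame and for all real `lam₁, …, lamₙ`,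
`∑_{k,m} Q_{m m̄ k k̄} (lamₖ² - lamₖ lamₘ) ≥ 0`.  (The numbers `Q_{m m̄ k k̄}` are real.) -/
def QNonneg : Prop :=
  ∀ e ∈ holCharts n X, ∀ y ∈ e.target, ∀ u : Fin n → Fin n → ℂ, g.IsUnitaryFrame e y u →
    ∀ lam : Fin n → ℝ,
      0 ≤ ∑ k, ∑ m, (g.QEval e y (u m) (u m) (u k) (u k)).re * (lam k ^ 2 - lam k * lam m)

/-- The endomorphism of the holomorphic tangent space given by a real `(1,1)`-form and the metric,
`(ρ X)ʲ = g^{j m̄} ρ_{i m̄} Xⁱ`, as a matrix in a chart. -/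
def endo (ρ : RealOneOneForm n X) (y : Cn n) : Matrix (Fin n) (Fin n) ℂ :=
  Matrix.of fun j i => ∑ m, g.inv e j m y * ρ.comp e i m y

/-- The eigenspace of `ρ` with respect to the metric for the real eigenvalue `lam`. -/
def eigenspace (ρ : RealOneOneForm n X) (y : Cn n) (lam : ℝ) : Submodule ℂ (Fin n → ℂ) :=
  Module.End.eigenspace (Matrix.toLin' (g.endo e ρ y)) (lam : ℂ)

/-- The trace `g^{i j̄} ρ_{i j̄}` is a constant function on the manifold. -/
def HasConstantTrace (ρ : RealOneOneForm n X) : Prop :=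
  ∃ c : ℂ, ∀ e ∈ holCharts n X, ∀ y ∈ e.target,
    ∑ i, ∑ j, g.inv e i j y * ρ.comp e i j y = c

/-- Bismut connection coefficients in `(1,0)`-directions: `A_{il}^j = Γ_{li}^j`, so that
`∇⁺ᵢ Xʲ = ∂ᵢ Xʲ + A_{il}^j Xˡ`. -/
def bismut (i l j : Fin n) (y : Cn n) : ℂ := g.Gam e l i j y

/-- Bismut connection coefficients in `(0,1)`-directions: `A_{ī l}^j = g^{j m̄} conj(T_{im l̄})`,
so that `∇⁺_{ī} Xʲ = ∂_{ī} Xʲ + A_{ī l}^j Xˡ`. -/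
def bismutBar (i l j : Fin n) (y : Cn n) : ℂ :=
  ∑ m, g.inv e j m y * star (g.torsionLow e i m l y)

/-- `∇⁺ρ = 0` for the Bismut connection.  The connection preserves types, so the components of
`∇⁺ρ` are
`∇⁺ᵢ ρ_{k j̄} = ∂ᵢ ρ_{k j̄} - A_{ik}^m ρ_{m j̄} - conj(A_{ī j}^m) ρ_{k m̄}` and
`∇⁺_{ī} ρ_{k j̄} = ∂_{ī} ρ_{k j̄} - A_{ī k}^m ρ_{m j̄} - conj(A_{ij}^m) ρ_{k m̄}`. -/
def BismutParallel (ρ : RealOneOneForm n X) : Prop :=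
  ∀ e ∈ holCharts n X, ∀ y ∈ e.target, ∀ i k j : Fin n,
    dz i (ρ.comp e k j) y - ∑ m, g.bismut e i k m y * ρ.comp e m j y
        - ∑ m, star (g.bismutBar e i j m y) * ρ.comp e k m y = 0 ∧
    dzbar i (ρ.comp e k j) y - ∑ m, g.bismutBar e i k m y * ρ.comp e m j y
        - ∑ m, star (g.bismut e i j m y) * ρ.comp e k m y = 0

end HermitianMetric

end

end HermitianGeometry

end

/-! ### Wirtinger calculus for scalar and matrix valued functions. -/

noncomputable section

namespace HermitianGeometry

open Topology

/-! The proof is a Bochner argument for `|ρ|² = tr (P G⁻¹)²`, where `G = (g_{i j̄})` and `P = (ρ_{i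
j̄})`. This function is a subsolution for the operator `g^{k l̄} ∂_k ∂_{l̄}`. The strong maximum
principle on the compact manifold makes it locally constant, and then the nonnegative terms in its
Laplacian vanish one by one.

Bochner formula (`bochner_algebra`, `bochner_formula`). A linear change of coordinates gives `G = 1`
and `P = diag(λ)` at a given point. The first derivatives `a_k = ∂_k G` are kept, since torsion
prevents normalizing them away; put `r_k = ∂_k P` and `H = P G⁻¹`. Constancy of the trace allows
`∑_k λ_k ∂_{k̄} ∂_k tr H = 0` to be subtracted. Closedness makes `∂_{k̄} ∂_k ρ_{i ī}` symmetric in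
`i`, `k`, so the second derivatives of `P` cancel. The second derivatives of `G` are completed to
the curvature, and then to `Q`. What remains is quadratic in `a` and `r`. Closedness also gives
`r_{k i j} = r_{i k j}`, and symmetrizing in `k`, `i` and completing the square in `r` yields `∑_k
∂_{k̄} ∂_k |ρ|² = 2 (∑ Q_{m m̄ k k̄} (λ_k² - λ_k λ_m) + ∑ |D_{k i j}|² + ¼ ∑ (λ_i + λ_k - λ_j)²
|T_{k i j̄}|²)` with `D` = `gradDefect`. `Q`-nonnegativity makes the right side nonnegative.

Maximum principle (`eventuallyEq_of_isLocalMax`, `normSq_eventuallyEq`). The operator has no first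
order part, so at each point it is a sum of second derivatives along a constant frame, namely the
linear normal frame of that point. Hopf's argument needs only uniform bounds on these frames, with
no continuity in the point.

Conclusion (`exists_rigid_linChart`). Now `D = 0` and `(λ_i + λ_k - λ_j) T_{k i j̄} = 0` in the
normal chart. The second equation is the torsion statement in an eigenbasis. The first statement
follows because in the same chart `∇⁺_i ρ_{k j̄} = D_{i k j} + ½ (λ_i + λ_k - λ_j) T_{k i j̄}`, and
the components of `∇⁺ρ` transform tensorially under linear changes. -/

/-- The first order operator `(∂/∂xⁱ + s ∂/∂yⁱ) / 2`; for `s = -√-1` and `s = √-1` these are the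
Wirtinger derivatives. -/
def wirt {n : ℕ} (s : ℂ) (i : Fin n) (f : Cn n → ℂ) (y : Cn n) : ℂ :=
  (1 / 2 : ℂ) * (fderiv ℝ f y (stdVec i) + s * fderiv ℝ f y (Complex.I • stdVec i))

theorem dz_eq_wirt {n : ℕ} (i : Fin n) (f : Cn n → ℂ) (y : Cn n) :
    dz i f y = wirt (-Complex.I) i f y := by
  simp only [dz, wirt]; ring

theorem dzbar_eq_wirt {n : ℕ} (i : Fin n) (f : Cn n → ℂ) (y : Cn n) :
    dzbar i f y = wirt Complex.I i f y := rfl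

section Scalar

variable {n : ℕ} {s t : ℂ} {i j : Fin n} {f g : Cn n → ℂ} {y : Cn n} {U : Set (Cn n)}

theorem wirt_congr (h : f =ᶠ[𝓝 y] g) : wirt s i f y = wirt s i g y := by
  simp only [wirt, h.fderiv_eq]

theorem wirt_const (c : ℂ) : wirt s i (fun _ => c) y = 0 := by
  simp [wirt]

theorem wirt_add (hf : DifferentiableAt ℝ f y) (hg : DifferentiableAt ℝ g y) :
    wirt s i (fun z => f z + g z) y = wirt s i f y + wirt s i g y := by
  simp only [wirt, fderiv_fun_add hf hg, add_apply]; ring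

theorem wirt_sub (hf : DifferentiableAt ℝ f y) (hg : DifferentiableAt ℝ g y) :
    wirt s i (fun z => f z - g z) y = wirt s i f y - wirt s i g y := by
  simp only [wirt, fderiv_fun_sub hf hg, sub_apply]; ring

theorem wirt_mul (hf : DifferentiableAt ℝ f y) (hg : DifferentiableAt ℝ g y) :
    wirt s i (fun z => f z * g z) y = wirt s i f y * g y + f y * wirt s i g y := by
  simp only [wirt, fderiv_fun_mul hf hg, add_apply,
    smul_apply, smul_eq_mul]
  ring

theorem wirt_const_mul (c : ℂ) (hf : DifferentiableAt ℝ f y) :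
    wirt s i (fun z => c * f z) y = c * wirt s i f y := by
  rw [wirt_mul (differentiableAt_const c) hf, wirt_const]; ring

theorem wirt_sum {ι : Type*} (S : Finset ι) {F : ι → Cn n → ℂ}
    (hF : ∀ a ∈ S, DifferentiableAt ℝ (F a) y) :
    wirt s i (fun z => ∑ a ∈ S, F a z) y = ∑ a ∈ S, wirt s i (F a) y := by
  simp only [wirt, fderiv_fun_sum hF, sum_apply, Finset.mul_sum,
    ← Finset.sum_add_distrib]

theorem star_wirt (hf : DifferentiableAt ℝ f y) :
    star (wirt s i f y) = wirt (star s) i (fun z => star (f z)) y := by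
  have h : fderiv ℝ (fun z => star (f z)) y = (Complex.conjCLE : ℂ →L[ℝ] ℂ).comp (fderiv ℝ f y) :=
    ((Complex.conjCLE : ℂ →L[ℝ] ℂ).hasFDerivAt.comp y hf.hasFDerivAt).fderiv
  simp only [wirt, h]
  simp

theorem wirt_re (hf : DifferentiableAt ℝ f y) (v : Cn n) :
    fderiv ℝ (fun z => (f z).re) y v = (fderiv ℝ f y v).re := by
  have h : fderiv ℝ (fun z => (f z).re) y = Complex.reCLM.comp (fderiv ℝ f y) :=
    (Complex.reCLM.hasFDerivAt.comp y hf.hasFDerivAt).fderiv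
  simp [h]

theorem contDiffOn_fderiv_apply (hU : IsOpen U) (hf : ContDiffOn ℝ ∞ f U) (v : Cn n) :
    ContDiffOn ℝ ∞ (fun z => fderiv ℝ f z v) U :=
  (hf.fderiv_of_isOpen hU (m := ∞) (by simp)).clm_apply contDiffOn_const

theorem contDiffOn_wirt (hU : IsOpen U) (hf : ContDiffOn ℝ ∞ f U) :
    ContDiffOn ℝ ∞ (wirt s i f) U :=
  contDiffOn_const.mul ((contDiffOn_fderiv_apply hU hf _).add
    (contDiffOn_const.mul (contDiffOn_fderiv_apply hU hf _)))

theorem differentiableAt_of_smoothOn (hU : IsOpen U) (hf : ContDiffOn ℝ ∞ f U) (hy : y ∈ U) :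
    DifferentiableAt ℝ f y :=
  (hf.contDiffAt (hU.mem_nhds hy)).differentiableAt (by simp)

theorem fderiv_fderiv_apply (hU : IsOpen U) (hf : ContDiffOn ℝ ∞ f U) (hy : y ∈ U) (v w : Cn n) :
    fderiv ℝ (fun z => fderiv ℝ f z v) y w = fderiv ℝ (fderiv ℝ f) y w v := by
  have hd : DifferentiableAt ℝ (fderiv ℝ f) y :=
    ((hf.fderiv_of_isOpen hU (m := ∞) (by simp)).contDiffAt (hU.mem_nhds hy)).differentiableAt
      (by simp)
  rw [fderiv_clm_apply hd (differentiableAt_const v)]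
  simp

theorem wirt_wirt (hU : IsOpen U) (hf : ContDiffOn ℝ ∞ f U) (hy : y ∈ U) :
    wirt s i (wirt t j f) y = (1 / 4 : ℂ) * (fderiv ℝ (fderiv ℝ f) y (stdVec i) (stdVec j)
      + t * fderiv ℝ (fderiv ℝ f) y (stdVec i) (Complex.I • stdVec j)
      + s * fderiv ℝ (fderiv ℝ f) y (Complex.I • stdVec i) (stdVec j)
      + s * t * fderiv ℝ (fderiv ℝ f) y (Complex.I • stdVec i) (Complex.I • stdVec j)) := by
  have hd := fun v => differentiableAt_of_smoothOn hU (contDiffOn_fderiv_apply hU hf v) hy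
  have h : ∀ w, fderiv ℝ (wirt t j f) y w = (1 / 2 : ℂ) * (fderiv ℝ (fderiv ℝ f) y w (stdVec j)
      + t * fderiv ℝ (fderiv ℝ f) y w (Complex.I • stdVec j)) := by
    intro w
    unfold wirt
    rw [fderiv_const_mul ((hd _).fun_add ((hd _).const_mul _)),
      fderiv_fun_add (hd _) ((hd _).const_mul _), fderiv_const_mul (hd _)]
    simp only [smul_apply, add_apply, smul_eq_mul,
      fderiv_fderiv_apply hU hf hy]
  rw [wirt, h, h]
  ring

/-- Symmetry of the real second derivative. Treating both Wirtinger operators as one operator with a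
parameter covers all combinations of barred and unbarred derivatives at once. -/
theorem wirt_comm (hU : IsOpen U) (hf : ContDiffOn ℝ ∞ f U) (hy : y ∈ U) :
    wirt s i (wirt t j f) y = wirt t j (wirt s i f) y := by
  have hsymm : IsSymmSndFDerivAt ℝ f y :=
    (hf.contDiffAt (hU.mem_nhds hy)).isSymmSndFDerivAt
      (by rw [minSmoothness_of_isRCLikeNormedField]; exact ENat.LEInfty.out)
  rw [wirt_wirt hU hf hy, wirt_wirt hU hf hy, hsymm (stdVec j) (stdVec i),
    hsymm (stdVec j) (Complex.I • stdVec i), hsymm (Complex.I • stdVec j) (stdVec i),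
    hsymm (Complex.I • stdVec j) (Complex.I • stdVec i)]
  ring

/-- `4 ∂²f/∂zⁱ∂z̄ⁱ` is the Laplacian in the `zⁱ`-plane. -/
theorem four_mul_wirt_wirt_re (hU : IsOpen U) (hf : ContDiffOn ℝ ∞ f U) (hy : y ∈ U) :
    4 * (wirt Complex.I i (wirt (-Complex.I) i f) y).re =
      fderiv ℝ (fun z => fderiv ℝ (fun z => (f z).re) z (stdVec i)) y (stdVec i)
      + fderiv ℝ (fun z => fderiv ℝ (fun z => (f z).re) z (Complex.I • stdVec i)) y
        (Complex.I • stdVec i) := by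
  have hsymm : IsSymmSndFDerivAt ℝ f y :=
    (hf.contDiffAt (hU.mem_nhds hy)).isSymmSndFDerivAt
      (by rw [minSmoothness_of_isRCLikeNormedField]; exact ENat.LEInfty.out)
  have h : ∀ v w, fderiv ℝ (fun z => fderiv ℝ (fun z => (f z).re) z v) y w =
      (fderiv ℝ (fderiv ℝ f) y w v).re := by
    intro v w
    have h1 : (fun z => fderiv ℝ (fun z => (f z).re) z v) =ᶠ[𝓝 y] fun z => (fderiv ℝ f z v).re := by
      filter_upwards [hU.mem_nhds hy] with z hz
      exact wirt_re (differentiableAt_of_smoothOn hU hf hz) v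
    rw [h1.fderiv_eq,
      wirt_re (differentiableAt_of_smoothOn hU (contDiffOn_fderiv_apply hU hf v) hy),
      fderiv_fderiv_apply hU hf hy]
  rw [wirt_wirt hU hf hy, h, h, hsymm (Complex.I • stdVec i) (stdVec i)]
  simp only [neg_mul, mul_neg, Complex.I_mul_I, neg_neg, one_mul]
  rw [show ∀ a b c : ℂ, (1 / 4 : ℂ) * (a + -(Complex.I * b) + Complex.I * b + c) =
    ((1 / 4 : ℝ) : ℂ) * (a + c) by intros; push_cast; ring, Complex.re_ofReal_mul, Complex.add_re]
  ring

end Scalar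

section MatrixValued

variable {n : ℕ} {m : ℕ} {s t : ℂ} {i j : Fin n}
  {F G : Cn n → Matrix (Fin m) (Fin m) ℂ} {y : Cn n} {U : Set (Cn n)}

/-- Entrywise smoothness of a matrix valued function. -/
def SmoothMatOn (F : Cn n → Matrix (Fin m) (Fin m) ℂ) (U : Set (Cn n)) : Prop :=
  ∀ a b, ContDiffOn ℝ ∞ (fun z => F z a b) U

/-- Entrywise `wirt`. -/
def wirtMat (s : ℂ) (i : Fin n) (F : Cn n → Matrix (Fin m) (Fin m) ℂ) (y : Cn n) :
    Matrix (Fin m) (Fin m) ℂ :=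
  Matrix.of fun a b => wirt s i (fun z => F z a b) y

theorem wirtMat_apply (a b : Fin m) : wirtMat s i F y a b = wirt s i (fun z => F z a b) y := rfl

theorem SmoothMatOn.mul (hF : SmoothMatOn F U) (hG : SmoothMatOn G U) :
    SmoothMatOn (fun z => F z * G z) U := fun a b => by
  simp only [Matrix.mul_apply]
  exact ContDiffOn.sum fun c _ => (hF a c).mul (hG c b)

theorem SmoothMatOn.wirtMat (hU : IsOpen U) (hF : SmoothMatOn F U) :
    SmoothMatOn (wirtMat s i F) U := fun a b => contDiffOn_wirt hU (hF a b)

theorem SmoothMatOn.trace (hF : SmoothMatOn F U) :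
    ContDiffOn ℝ ∞ (fun z => (F z).trace) U :=
  ContDiffOn.sum fun c _ => hF c c

theorem SmoothMatOn.inv (hF : SmoothMatOn F U) (h : ∀ z ∈ U, (F z).det ≠ 0) :
    SmoothMatOn (fun z => (F z)⁻¹) U := fun a b => by
  have hdet : ∀ F : Cn n → Matrix (Fin m) (Fin m) ℂ, SmoothMatOn F U →
      ContDiffOn ℝ ∞ (fun z => (F z).det) U := fun F hF => by
    simp only [Matrix.det_apply']
    exact ContDiffOn.sum fun σ _ => contDiffOn_const.mul (contDiffOn_prod fun c _ => hF _ _)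
  have : (fun z => (F z)⁻¹ a b) = fun z => (F z).det⁻¹ * (F z).adjugate a b := by
    funext z
    rw [Matrix.inv_def, Ring.inverse_eq_inv']
    rfl
  rw [this]
  refine ((hdet F hF).inv h).mul ?_
  -- An entry of the adjugate is the determinant of `F` with one row replaced by constants, so
  -- smoothness of determinants suffices.
  simp only [Matrix.adjugate_apply]
  refine hdet _ fun c d => ?_
  simp only [Matrix.updateRow_apply]
  split_ifs
  · exact contDiffOn_const
  · exact hF c d

theorem wirtMat_congr (h : F =ᶠ[𝓝 y] G) : wirtMat s i F y = wirtMat s i G y := by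
  ext a b
  exact wirt_congr (h.mono fun z hz => by simp only [hz])

theorem wirtMat_mul (hU : IsOpen U) (hF : SmoothMatOn F U) (hG : SmoothMatOn G U) (hy : y ∈ U) :
    wirtMat s i (fun z => F z * G z) y = wirtMat s i F y * G y + F y * wirtMat s i G y := by
  ext a b
  have h1 := fun a b => differentiableAt_of_smoothOn hU (hF a b) hy
  have h2 := fun a b => differentiableAt_of_smoothOn hU (hG a b) hy
  simp only [wirtMat_apply, Matrix.add_apply, Matrix.mul_apply]
  rw [wirt_sum _ fun c _ => (h1 a c).fun_mul (h2 c b), ← Finset.sum_add_distrib]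
  exact Finset.sum_congr rfl fun c _ => wirt_mul (h1 a c) (h2 c b)

theorem wirtMat_sub (hU : IsOpen U) (hF : SmoothMatOn F U) (hG : SmoothMatOn G U) (hy : y ∈ U) :
    wirtMat s i (fun z => F z - G z) y = wirtMat s i F y - wirtMat s i G y := by
  ext a b
  exact wirt_sub (differentiableAt_of_smoothOn hU (hF a b) hy)
    (differentiableAt_of_smoothOn hU (hG a b) hy)

theorem wirt_trace (hU : IsOpen U) (hF : SmoothMatOn F U) (hy : y ∈ U) :
    wirt s i (fun z => (F z).trace) y = (wirtMat s i F y).trace :=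
  wirt_sum _ fun c _ => differentiableAt_of_smoothOn hU (hF c c) hy

/-- Differentiate `F F⁻¹ = 1`. -/
theorem wirtMat_inv (hU : IsOpen U) (hF : SmoothMatOn F U)
    (h : ∀ z ∈ U, (F z).det ≠ 0) (hy : y ∈ U) :
    wirtMat s i (fun z => (F z)⁻¹) y = -((F y)⁻¹ * wirtMat s i F y * (F y)⁻¹) := by
  have hu : IsUnit (F y).det := isUnit_iff_ne_zero.2 (h y hy)
  have h1 := wirtMat_mul (s := s) (i := i) hU hF (hF.inv h) hy
  have h2 : wirtMat s i (fun z => F z * (F z)⁻¹) y = 0 := by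
    rw [wirtMat_congr (G := fun _ => 1)]
    · ext a b
      exact wirt_const _
    · filter_upwards [hU.mem_nhds hy] with z hz
      exact Matrix.mul_nonsing_inv _ (isUnit_iff_ne_zero.2 (h z hz))
  rw [h2] at h1
  have h3 := congrArg (fun M => (F y)⁻¹ * M) h1.symm
  simp only [mul_add, mul_zero, ← mul_assoc, Matrix.nonsing_inv_mul _ hu, one_mul] at h3
  exact eq_neg_of_add_eq_zero_right h3

theorem star_wirtMat_apply (hU : IsOpen U) (hF : SmoothMatOn F U)
    (hh : ∀ z ∈ U, (F z).IsHermitian) (hy : y ∈ U) :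
    wirtMat (star s) i F y = (wirtMat s i F y).conjTranspose := by
  ext a b
  rw [Matrix.conjTranspose_apply, wirtMat_apply, wirtMat_apply,
    star_wirt (differentiableAt_of_smoothOn hU (hF b a) hy)]
  refine wirt_congr ?_
  filter_upwards [hU.mem_nhds hy] with z hz
  exact ((hh z hz).apply a b).symm

end MatrixValued

end HermitianGeometry

end

/-! ### The strong maximum principle of Hopf. -/

noncomputable section

namespace HermitianGeometry

open Topology Metric
open scoped InnerProductSpace

section MaximumPrinciple

variable {E : Type*} [NormedAddCommGroup E] [InnerProductSpace ℝ E]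

theorem contDiffOn_fderiv_apply_one {F : E → ℝ} {U : Set E} (hU : IsOpen U)
    (hF : ContDiffOn ℝ 2 F U) (u : E) : ContDiffOn ℝ 1 (fun z => fderiv ℝ F z u) U :=
  (hF.fderiv_of_isOpen hU (m := 1) (by norm_num)).clm_apply contDiffOn_const

/-- The second derivative test, necessary condition. -/
theorem second_deriv_nonpos_of_isLocalMax {F : E → ℝ} {U : Set E} (hU : IsOpen U)
    (hF : ContDiffOn ℝ 2 F U) {x : E} (hx : x ∈ U) (hmax : IsLocalMax F x) (u : E) :
    fderiv ℝ (fun z => fderiv ℝ F z u) x u ≤ 0 := by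
  by_contra! hpos
  set h : ℝ → ℝ := fun t => F (x + t • u) with hh
  have hl : ∀ t : ℝ, HasDerivAt (fun t : ℝ => x + t • u) u t := fun t => by
    simpa using ((hasDerivAt_id t).smul_const u).const_add x
  have hlc : Filter.Tendsto (fun t : ℝ => x + t • u) (𝓝 0) (𝓝 x) := by
    simpa using (hl 0).continuousAt.tendsto
  have hd : ∀ᶠ t in 𝓝 (0 : ℝ), HasDerivAt h (fderiv ℝ F (x + t • u) u) t := by
    filter_upwards [hlc (hU.mem_nhds hx)] with t ht
    exact (((hF.contDiffAt (hU.mem_nhds ht)).differentiableAt (by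
      norm_num)).hasFDerivAt).comp_hasDerivAt
      t (hl t)
  have hd2 : HasDerivAt (fun t : ℝ => fderiv ℝ F (x + t • u) u)
      (fderiv ℝ (fun z => fderiv ℝ F z u) x u) 0 := by
    have := ((contDiffOn_fderiv_apply_one hU hF u).contDiffAt (hU.mem_nhds hx)).differentiableAt
      (by norm_num)
    have h2 : HasFDerivAt (fun z => fderiv ℝ F z u) (fderiv ℝ (fun z => fderiv ℝ F z u) x)
      (x + (0 : ℝ) • u) := by simpa using this.hasFDerivAt
    exact h2.comp_hasDerivAt 0 (hl 0)
  have hderiv : deriv h =ᶠ[𝓝 0] fun t => fderiv ℝ F (x + t • u) u := hd.mono fun t ht => ht.deriv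
  have hmax' : IsLocalMax h 0 := by
    have : IsLocalMax F (x + (0 : ℝ) • u) := by simpa using hmax
    exact this.comp_tendsto (g := fun t : ℝ => x + t • u) (by simpa using hlc)
  have h0 : deriv h 0 = 0 := hmax'.deriv_eq_zero
  have h2 : deriv (deriv h) 0 = fderiv ℝ (fun z => fderiv ℝ F z u) x u := by
    rw [hderiv.deriv_eq, hd2.deriv]
  -- A positive second derivative would make `0` a local minimum as well, so `h` would be constant
  -- near `0` and its second derivative zero.
  have hmin : IsLocalMin h 0 := isLocalMin_of_deriv_deriv_pos (by rw [h2]; exact hpos) h0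
    hd.self_of_nhds.continuousAt
  have hconst : h =ᶠ[𝓝 0] fun _ => h 0 := by
    filter_upwards [hmax', hmin] with t h1 h2 using le_antisymm h1 h2
  have h3 : deriv (deriv h) 0 = 0 := by
    have : deriv h =ᶠ[𝓝 0] fun _ => 0 := by
      filter_upwards [hconst.eventuallyEq_nhds] with t ht
      rw [ht.deriv_eq]; simp
    rw [this.deriv_eq]; simp
  rw [h2] at h3
  exact hpos.ne' h3

/-- The derivatives of the barrier function `exp (-α |x - p|²)`. -/
theorem fderiv_barrier (α : ℝ) (p x u : E) :
    fderiv ℝ (fun z => Real.exp (-α * ‖z - p‖ ^ 2)) x u =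
      -(2 * α) * ⟪x - p, u⟫_ℝ * Real.exp (-α * ‖x - p‖ ^ 2) := by
  have h := ((((hasFDerivAt_id x).sub_const p).norm_sq).const_mul (-α)).exp
  rw [HasFDerivAt.fderiv (f := fun z => Real.exp (-α * ‖z - p‖ ^ 2)) h]
  simp [inner_sub_left (𝕜 := ℝ) x p u]
  ring

theorem fderiv_fderiv_barrier (α : ℝ) (p x u : E) :
    fderiv ℝ (fun z => fderiv ℝ (fun z => Real.exp (-α * ‖z - p‖ ^ 2)) z u) x u =
      (4 * α ^ 2 * ⟪x - p, u⟫_ℝ ^ 2 - 2 * α * ‖u‖ ^ 2) * Real.exp (-α * ‖x - p‖ ^ 2) := by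
  simp_rw [fderiv_barrier]
  have h := ((((hasFDerivAt_id x).sub_const p).norm_sq).const_mul (-α)).exp
  have h1 := ((((hasFDerivAt_id x).sub_const p).inner ℝ (hasFDerivAt_const u x)).const_mul
    (-(2 * α))).mul h
  rw [HasFDerivAt.fderiv (f := fun z => -(2 * α) * ⟪z - p, u⟫_ℝ * Real.exp (-α * ‖z - p‖ ^ 2)) h1]
  simp [inner_sub_left (𝕜 := ℝ) x p u]
  ring

theorem contDiff_barrier (α : ℝ) (p : E) :
    ContDiff ℝ 2 (fun z : E => Real.exp (-α * ‖z - p‖ ^ 2)) :=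
  (contDiff_const.mul ((contDiff_id.sub contDiff_const).norm_sq ℝ)).exp

/-- Hopf's strong maximum principle for subsolutions of a second order elliptic operator which at
`x` is the sum of the second derivatives in the directions `u k`. -/
theorem eventuallyEq_of_isLocalMax [FiniteDimensional ℝ E] {F : E → ℝ} {U : Set E} (hU : IsOpen U)
    (hF : ContDiffOn ℝ 2 F U) {ι : Type*} [Fintype ι] {C : ℝ}
    (hL : ∀ x ∈ U, ∃ u : ι → E, (∀ ξ, ‖ξ‖ ^ 2 ≤ C * ∑ k, ⟪ξ, u k⟫_ℝ ^ 2) ∧ ∑ k, ‖u k‖ ^ 2 ≤ C ∧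
      0 ≤ ∑ k, fderiv ℝ (fun z => fderiv ℝ F z (u k)) x (u k))
    {x₀ : E} (hx₀ : x₀ ∈ U) (hmax : IsLocalMax F x₀) : F =ᶠ[𝓝 x₀] fun _ => F x₀ := by
  obtain ⟨R, hR, hRU⟩ : ∃ R > 0, closedBall x₀ R ⊆ U ∩ {z | F z ≤ F x₀} :=
    nhds_basis_closedBall.mem_iff.1 (Filter.inter_mem (hU.mem_nhds hx₀) hmax)
  have hle : ∀ z ∈ closedBall x₀ R, F z ≤ F x₀ := fun z hz => (hRU hz).2
  have hRU' : closedBall x₀ R ⊆ U := fun z hz => (hRU hz).1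
  set M := F x₀ with hM
  have hcont : ContinuousOn F (closedBall x₀ R) := hF.continuousOn.mono hRU'
  -- With `y` this close to `x₀`, the nearest maximum point to `y` and the balls used below all stay
  -- inside the ball of radius `R`, where `F ≤ M`.
  suffices h : ∀ y ∈ ball x₀ (R / 4), F y = M by
    filter_upwards [ball_mem_nhds x₀ (by positivity : 0 < R / 4)] with y hy using h y hy
  intro y hy
  by_contra hne
  rw [mem_ball] at hy
  have hyR : closedBall y (R / 4) ⊆ closedBall x₀ R := closedBall_subset_closedBall' (by linarith)
  -- a nearest point `x₁` to `y` at which the maximum is attained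
  set S : Set E := closedBall x₀ R ∩ F ⁻¹' {M} with hS
  have hSc : IsCompact S := by
    refine (isCompact_closedBall x₀ R).of_isClosed_subset ?_ Set.inter_subset_left
    exact hcont.preimage_isClosed_of_isClosed isClosed_closedBall isClosed_singleton
  have hx₀S : x₀ ∈ S := ⟨mem_closedBall_self hR.le, rfl⟩
  obtain ⟨x₁, hx₁S, hx₁⟩ := hSc.exists_infDist_eq_dist ⟨x₀, hx₀S⟩ y
  have hmin : ∀ z ∈ S, dist y x₁ ≤ dist y z := fun z hz => hx₁ ▸ infDist_le_dist_of_mem hz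
  have hd1 : dist y x₁ < R / 4 := (hmin x₀ hx₀S).trans_lt hy
  have hyx : y ≠ x₁ := fun h => hne (h ▸ hx₁S.2)
  have hdpos : 0 < dist y x₁ := dist_pos.2 hyx
  -- the ball with diameter `[y, x₁]` touches `S` only at `x₁`
  set p : E := midpoint ℝ y x₁ with hp
  set r : ℝ := dist y x₁ / 2 with hr
  have hrpos : 0 < r := half_pos hdpos
  have hpy : dist p y = r := by rw [hp, dist_midpoint_left]; simp [hr]; ring
  have hpx : dist x₁ p = r := by rw [hp, dist_comm, dist_midpoint_right]; simp [hr]; ring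
  have htouch : ∀ z ∈ S, dist z p ≤ r → z = x₁ := by
    intro z hz hzp
    -- The vectors `p - y` and `z - p` have norm at most `r`, while their sum has norm at least `2
    -- r` because no point of `S` is closer to `y` than `x₁`. By the parallelogram law they
    -- coincide, so `z` is the reflection `2 p - y = x₁`.
    have hpm : p = (2 : ℝ)⁻¹ • (y + x₁) := by rw [hp, midpoint_eq_smul_add, invOf_eq_inv]
    have h1 : ‖(p - y) + (z - p)‖ = dist y z := by rw [dist_comm, dist_eq_norm]; congr 1; abel
    have h2 : ‖p - y‖ = r := by rw [← dist_eq_norm, hpy]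
    have h3 : ‖z - p‖ ≤ r := by rwa [← dist_eq_norm]
    have h4 : 2 * r ≤ dist y z := by rw [hr]; linarith [hmin z hz]
    have h5 := parallelogram_law_with_norm ℝ (p - y) (z - p)
    rw [h1, h2] at h5
    have h6 : ‖(p - y) - (z - p)‖ = 0 := by
      have : ‖(p - y) - (z - p)‖ * ‖(p - y) - (z - p)‖ ≤ 0 := by
        nlinarith [norm_nonneg (z - p)]
      exact mul_self_eq_zero.1 (le_antisymm this (mul_self_nonneg _))
    have h7 : z = (2 : ℝ) • p - y := by
      rw [norm_eq_zero, sub_eq_zero] at h6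
      rw [two_smul]
      rw [eq_comm, sub_eq_iff_eq_add] at h6
      rw [h6]; abel
    rw [h7, hpm, smul_smul]
    norm_num
  have hC : 0 < C := by
    obtain ⟨u, hu1, hu2, -⟩ := hL x₀ hx₀
    refine lt_of_le_of_ne ((Finset.sum_nonneg fun k _ => sq_nonneg _).trans hu2) fun h => ?_
    have := hu1 (y - x₁)
    rw [← h, zero_mul, ← dist_eq_norm] at this
    nlinarith
  -- the region on which the barrier is used
  set δ : ℝ := r / 2 with hδ
  have hD : closedBall x₁ δ ⊆ ball x₀ R := by
    refine fun z hz => ?_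
    rw [mem_closedBall] at hz
    have h1 := dist_triangle4 z x₁ y x₀
    rw [dist_comm x₁ y] at h1
    have h2 := hmin x₀ hx₀S
    rw [mem_ball]
    rw [hδ, hr] at hz
    linarith
  have hDr : ∀ z ∈ closedBall x₁ δ, r / 2 ≤ ‖z - p‖ := fun z hz => by
    rw [mem_closedBall, dist_comm] at hz
    have := dist_triangle x₁ z p
    rw [hpx] at this
    rw [← dist_eq_norm]
    rw [hδ] at hz
    linarith
  -- With `A = ∑ ⟪z - p, u k⟫²` and `B = ∑ ‖u k‖²`, the operator applied to the barrier is `2 α (2 α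
  -- A - B)` times the exponential. Since `(r / 2)² ≤ ‖z - p‖² ≤ C A` and `B ≤ C`, this choice of
  -- `α` makes it positive.
  obtain ⟨α, hα, hαr⟩ : ∃ α : ℝ, 0 < α ∧ C ^ 2 < 2 * α * (r / 2) ^ 2 := by
    refine ⟨(C ^ 2 + 1) / (2 * (r / 2) ^ 2), by positivity, ?_⟩
    have : (r / 2) ^ 2 ≠ 0 := by positivity
    field_simp
    linarith
  set v : E → ℝ := fun z => Real.exp (-α * ‖z - p‖ ^ 2) with hv
  set v₁ : ℝ := Real.exp (-α * r ^ 2) with hv₁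
  have hvx₁ : v x₁ = v₁ := by simp only [hv, hv₁]; rw [← dist_eq_norm, hpx]
  have hv1 : ∀ z, v z ≤ 1 := fun z => by
    simp only [hv, Real.exp_le_one_iff]
    have := mul_nonneg hα.le (sq_nonneg ‖z - p‖)
    linarith
  -- away from the touching point `F` is bounded away from `M`
  obtain ⟨η, hη, hFη⟩ : ∃ η > 0, ∀ z ∈ sphere x₁ δ, dist z p ≤ r → F z ≤ M - η := by
    have hKc : IsCompact (sphere x₁ δ ∩ closedBall p r) :=
      (isCompact_sphere x₁ δ).inter_right isClosed_closedBall
    have hKs : sphere x₁ δ ∩ closedBall p r ⊆ closedBall x₀ R := fun z hz =>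
      ball_subset_closedBall (hD (sphere_subset_closedBall hz.1))
    rcases (sphere x₁ δ ∩ closedBall p r).eq_empty_or_nonempty with hK | hK
    · refine ⟨1, one_pos, fun z hz hzp => absurd (show z ∈ sphere x₁ δ ∩ closedBall p r from
        ⟨hz, hzp⟩) (by simp [hK])⟩
    · obtain ⟨z₁, hz₁, hz₁max⟩ := hKc.exists_isMaxOn hK (hcont.mono hKs)
      refine ⟨M - F z₁, ?_, fun z hz hzp => ?_⟩
      · rw [gt_iff_lt, sub_pos]
        refine lt_of_le_of_ne (hle z₁ (hKs hz₁)) fun h => ?_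
        have := htouch z₁ ⟨hKs hz₁, h⟩ hz₁.2
        have h4 := hz₁.1
        rw [mem_sphere, this, dist_self] at h4
        rw [hδ] at h4; linarith
      · have := hz₁max (show z ∈ sphere x₁ δ ∩ closedBall p r from ⟨hz, hzp⟩)
        simp only [Set.mem_ofPred_eq] at this
        linarith
  -- On the part of the sphere inside the ball about `p`, `F ≤ M - η` and `v ≤ 1`, so `w ≤ M - η /
  -- 2`. On the rest, `v < v₁` and `F ≤ M`. Either way `w` is below its value `M + ε v₁` at the
  -- centre `x₁`, which forces an interior maximum of `w`.
  set ε : ℝ := η / 2 with hε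
  set w : E → ℝ := fun z => F z + ε * v z with hw
  have hwcont : ContinuousOn w (closedBall x₁ δ) :=
    (hcont.mono fun z hz => ball_subset_closedBall (hD hz)).add
      ((contDiff_barrier α p).continuous.const_mul ε).continuousOn
  have hwx₁ : w x₁ = M + ε * v₁ := by simp only [hw]; rw [hvx₁, hx₁S.2]
  have hbd : ∀ z ∈ sphere x₁ δ, w z < w x₁ := by
    intro z hz
    rw [hwx₁]
    simp only [hw]
    have hv₁pos : 0 < v₁ := Real.exp_pos _
    have hεp : 0 < ε := half_pos hη
    rcases le_or_gt (dist z p) r with h | h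
    · have := hFη z hz h
      nlinarith [hv1 z, mul_pos hεp hv₁pos]
    · have h1 : v z < v₁ := by
        simp only [hv, hv₁, Real.exp_lt_exp]
        rw [← dist_eq_norm]
        have : r ^ 2 < dist z p ^ 2 := by gcongr
        nlinarith
      have := hle z (ball_subset_closedBall (hD (sphere_subset_closedBall hz)))
      nlinarith
  obtain ⟨z, hz, hzmax⟩ := (isCompact_closedBall x₁ δ).exists_isMaxOn
    ⟨x₁, mem_closedBall_self (by positivity)⟩ hwcont
  have hzball : z ∈ ball x₁ δ := by
    rw [mem_ball]
    refine lt_of_le_of_ne hz fun h => ?_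
    exact absurd (hzmax (mem_closedBall_self (by positivity : 0 ≤ δ))) (not_le.2 (hbd z h))
  have hzU : z ∈ U := hRU' (ball_subset_closedBall (hD hz))
  have hwz : IsLocalMax w z := hzmax.isLocalMax
    (Filter.mem_of_superset (isOpen_ball.mem_nhds hzball) ball_subset_closedBall)
  have hv2 : ContDiffOn ℝ 2 v U := (contDiff_barrier α p).contDiffOn
  have hw2 : ContDiffOn ℝ 2 w U := hF.add (contDiffOn_const.mul hv2)
  obtain ⟨u, hu1, hu2, hu3⟩ := hL z hzU
  have hadd : ∀ k, fderiv ℝ (fun z => fderiv ℝ w z (u k)) z (u k) =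
      fderiv ℝ (fun z => fderiv ℝ F z (u k)) z (u k) +
        ε * fderiv ℝ (fun z => fderiv ℝ v z (u k)) z (u k) := by
    intro k
    have hd : ∀ {f : E → ℝ}, ContDiffOn ℝ 2 f U → ∀ x ∈ U, DifferentiableAt ℝ f x :=
      fun hf x hx => (hf.contDiffAt (hU.mem_nhds hx)).differentiableAt (by norm_num)
    have hd' : ∀ {f : E → ℝ}, ContDiffOn ℝ 2 f U →
        DifferentiableAt ℝ (fun z => fderiv ℝ f z (u k)) z := fun hf =>
      ((contDiffOn_fderiv_apply_one hU hf (u k)).contDiffAt (hU.mem_nhds hzU)).differentiableAt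
        (by norm_num)
    have h1 : (fun z => fderiv ℝ w z (u k)) =ᶠ[𝓝 z]
        fun z => fderiv ℝ F z (u k) + ε * fderiv ℝ v z (u k) := by
      filter_upwards [hU.mem_nhds hzU] with x hx
      simp only [hw]
      rw [fderiv_fun_add (hd hF x hx) ((hd hv2 x hx).const_mul ε), fderiv_const_mul (hd hv2 x hx)]
      simp
    rw [h1.fderiv_eq, fderiv_fun_add (hd' hF) ((hd' hv2).const_mul ε), fderiv_const_mul (hd' hv2)]
    simp
  have hpos : 0 < ∑ k, fderiv ℝ (fun z => fderiv ℝ v z (u k)) z (u k) := by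
    simp only [hv, fderiv_fderiv_barrier]
    rw [← Finset.sum_mul, Finset.sum_sub_distrib, ← Finset.mul_sum, ← Finset.mul_sum]
    refine mul_pos ?_ (Real.exp_pos _)
    have h1 := hu1 (z - p)
    have h2 : (r / 2) ^ 2 ≤ ‖z - p‖ ^ 2 := by
      have := hDr z hz
      gcongr
    set A := ∑ k, ⟪z - p, u k⟫_ℝ ^ 2
    set B := ∑ k, ‖u k‖ ^ 2
    have h3 : C ^ 2 < 2 * α * (C * A) := hαr.trans_le (by gcongr; linarith)
    have h4 : C < 2 * α * A := by nlinarith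
    nlinarith
  -- At the interior maximum of `w` the operator is nonpositive, yet it is nonnegative on `F` and
  -- strictly positive on the barrier.
  have hsum : ∑ k, fderiv ℝ (fun z => fderiv ℝ w z (u k)) z (u k) ≤ 0 :=
    Finset.sum_nonpos fun k _ => second_deriv_nonpos_of_isLocalMax hU hw2 hzU hwz (u k)
  simp only [hadd, Finset.sum_add_distrib, ← Finset.mul_sum] at hsum
  have := mul_pos (half_pos hη) hpos
  rw [← hε] at this
  linarith

end MaximumPrinciple

end HermitianGeometry

end

/-! ### The Bochner formula for `tr (P G⁻¹)²`. -/

noncomputable section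

namespace HermitianGeometry

open Topology Matrix

section Algebra

variable {n : ℕ}

theorem trace_conjTranspose_mul_eq_sum (A B : Matrix (Fin n) (Fin n) ℂ) :
    (Aᴴ * B).trace = ∑ i, ∑ j, star (A i j) * B i j := by
  simp only [trace, diag_apply, mul_apply, conjTranspose_apply]
  rw [Finset.sum_comm]

theorem trace_mul_conjTranspose_eq_sum (A B : Matrix (Fin n) (Fin n) ℂ) :
    (A * Bᴴ).trace = ∑ i, ∑ j, A i j * star (B i j) := by
  simp only [trace, diag_apply, mul_apply, conjTranspose_apply]

/-- The Bochner identity does not hold term by term, only after symmetrizing in the direction of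
differentiation and the first index of the matrix; this lemma performs the symmetrization. -/
theorem sum_eq_zero_of_antisymm {Z : Fin n → Fin n → ℝ} (h : ∀ k i, Z k i + Z i k = 0) :
    ∑ k, ∑ i, Z k i = 0 := by
  have h1 : ∑ k, ∑ i, Z k i = ∑ k, ∑ i, Z i k := Finset.sum_comm
  have h2 : ∑ k, ∑ i, (Z k i + Z i k) = 0 := by simp [h]
  simp only [Finset.sum_add_distrib] at h2
  linarith

/-- The second derivative of `H = P G⁻¹` at a point at which `G = 1` and `P = Λ`, in terms of the
derivatives `a`, `a₂` of `G` and `r`, `r₂` of `P`. -/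
def endoHess (Λ a a₂ r r₂ : Matrix (Fin n) (Fin n) ℂ) : Matrix (Fin n) (Fin n) ℂ :=
  r₂ - r * aᴴ - rᴴ * a + Λ * aᴴ * a - Λ * a₂ + Λ * a * aᴴ

variable (lam : Fin n → ℝ)

/-- This expansion and the next two put all traces of the Bochner formula into the same shape, a sum
over entries with `|a|²`, `|r|²` and `Re (r ā)`, so that they can be compared entry by entry. -/
theorem trace_endoHess (a a₂ r r₂ : Matrix (Fin n) (Fin n) ℂ) :
    (endoHess (diagonal fun i => (lam i : ℂ)) a a₂ r r₂).trace.re =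
      ∑ i, ((r₂ i i).re - lam i * (a₂ i i).re) + ∑ i, ∑ j, (-2 * (r i j * star (a i j)).re
        + (lam i + lam j) * Complex.normSq (a i j)) := by
  set Λ : Matrix (Fin n) (Fin n) ℂ := diagonal fun i => (lam i : ℂ) with hΛ
  have hΛh : Λᴴ = Λ := by
    rw [hΛ, diagonal_conjTranspose]; congr 1; ext i; simp
  have e1 : (Λ * aᴴ * a).trace = ∑ i, ∑ j, star (a i j * lam j) * a i j := by
    rw [show Λ * aᴴ = (a * Λ)ᴴ by rw [conjTranspose_mul, hΛh], trace_conjTranspose_mul_eq_sum]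
    simp only [hΛ, mul_diagonal]
  have e2 : (Λ * a * aᴴ).trace = ∑ i, ∑ j, lam i * a i j * star (a i j) := by
    rw [trace_mul_conjTranspose_eq_sum]
    simp only [hΛ, diagonal_mul]
  have e3 : (Λ * a₂).trace = ∑ i, lam i * a₂ i i := by
    simp only [hΛ, trace, diag_apply, diagonal_mul]
  rw [endoHess, trace_add, trace_sub, trace_add, trace_sub, trace_sub, e1, e2, e3,
    trace_mul_conjTranspose_eq_sum, trace_conjTranspose_mul_eq_sum]
  simp only [trace, diag_apply, Complex.add_re, Complex.sub_re, Complex.re_sum,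
    Finset.sum_sub_distrib, Complex.re_ofReal_mul]
  have : ∑ i, ∑ j, (-2 * (r i j * star (a i j)).re + (lam i + lam j) * Complex.normSq (a i j)) =
      - (∑ i, ∑ j, (r i j * star (a i j)).re) - (∑ i, ∑ j, (star (r i j) * a i j).re)
        + (∑ i, ∑ j, (star (a i j * lam j) * a i j).re)
        + ∑ i, ∑ j, (lam i * a i j * star (a i j)).re := by
    simp only [← Finset.sum_neg_distrib, ← Finset.sum_sub_distrib, ← Finset.sum_add_distrib]
    refine Finset.sum_congr rfl fun i _ => Finset.sum_congr rfl fun j _ => ?_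
    simp [Complex.normSq_apply]
    ring
  rw [this]
  ring

theorem trace_diagonal_mul_endoHess (a a₂ r r₂ : Matrix (Fin n) (Fin n) ℂ) :
    (diagonal (fun i => (lam i : ℂ)) *
      endoHess (diagonal fun i => (lam i : ℂ)) a a₂ r r₂).trace.re =
      ∑ i, (lam i * (r₂ i i).re - lam i ^ 2 * (a₂ i i).re) +
        ∑ i, ∑ j, (-(lam i + lam j) * (r i j * star (a i j)).re
        + (lam i ^ 2 + lam j ^ 2) * Complex.normSq (a i j)) := by
  set Λ : Matrix (Fin n) (Fin n) ℂ := diagonal fun i => (lam i : ℂ) with hΛ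
  have hΛh : Λᴴ = Λ := by
    rw [hΛ, diagonal_conjTranspose]; congr 1; ext i; simp
  have e1 : (Λ * (Λ * aᴴ * a)).trace = ∑ i, ∑ j, star (a i j * lam j * lam j) * a i j := by
    rw [show Λ * (Λ * aᴴ * a) = (a * Λ * Λ)ᴴ * a by
      simp only [conjTranspose_mul, hΛh, Matrix.mul_assoc], trace_conjTranspose_mul_eq_sum]
    simp only [hΛ, mul_diagonal]
  have e2 : (Λ * (Λ * a * aᴴ)).trace = ∑ i, ∑ j, lam i * (lam i * a i j) * star (a i j) := by
    rw [← Matrix.mul_assoc, trace_mul_conjTranspose_eq_sum]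
    simp only [hΛ, diagonal_mul]
  have e3 : (Λ * (Λ * a₂)).trace = ∑ i, lam i * (lam i * a₂ i i) := by
    simp only [hΛ, trace, diag_apply, diagonal_mul]
  have e4 : (Λ * r₂).trace = ∑ i, lam i * r₂ i i := by
    simp only [hΛ, trace, diag_apply, diagonal_mul]
  have e5 : (Λ * (r * aᴴ)).trace = ∑ i, ∑ j, lam i * r i j * star (a i j) := by
    rw [← Matrix.mul_assoc, trace_mul_conjTranspose_eq_sum]
    simp only [hΛ, diagonal_mul]
  have e6 : (Λ * (rᴴ * a)).trace = ∑ i, ∑ j, star (r i j * lam j) * a i j := by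
    rw [show Λ * (rᴴ * a) = (r * Λ)ᴴ * a by
      simp only [conjTranspose_mul, hΛh, Matrix.mul_assoc], trace_conjTranspose_mul_eq_sum]
    simp only [hΛ, mul_diagonal]
  rw [endoHess, mul_add, mul_sub, mul_add, mul_sub, mul_sub, trace_add, trace_sub, trace_add,
    trace_sub, trace_sub, e1, e2, e3, e4, e5, e6]
  simp only [Complex.add_re, Complex.sub_re, Complex.re_sum,
    Finset.sum_sub_distrib, Complex.re_ofReal_mul]
  have : ∑ i, ∑ j, (-(lam i + lam j) * (r i j * star (a i j)).re
        + (lam i ^ 2 + lam j ^ 2) * Complex.normSq (a i j)) =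
      - (∑ i, ∑ j, (lam i * r i j * star (a i j)).re)
        - (∑ i, ∑ j, (star (r i j * lam j) * a i j).re)
        + (∑ i, ∑ j, (star (a i j * lam j * lam j) * a i j).re)
        + ∑ i, ∑ j, (lam i * (lam i * a i j) * star (a i j)).re := by
    simp only [← Finset.sum_neg_distrib, ← Finset.sum_sub_distrib, ← Finset.sum_add_distrib]
    refine Finset.sum_congr rfl fun i _ => Finset.sum_congr rfl fun j _ => ?_
    simp [Complex.normSq_apply]
    ring
  rw [this]
  ring_nf

theorem trace_grad_sq (a r : Matrix (Fin n) (Fin n) ℂ) :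
    ((rᴴ - diagonal (fun i => (lam i : ℂ)) * aᴴ) *
      (r - diagonal (fun i => (lam i : ℂ)) * a)).trace.re =
      ∑ i, ∑ j, (Complex.normSq (r i j) - (lam i + lam j) * (r i j * star (a i j)).re
        + lam i * lam j * Complex.normSq (a i j)) := by
  set Λ : Matrix (Fin n) (Fin n) ℂ := diagonal fun i => (lam i : ℂ) with hΛ
  have hΛh : Λᴴ = Λ := by
    rw [hΛ, diagonal_conjTranspose]; congr 1; ext i; simp
  rw [show rᴴ - Λ * aᴴ = (r - a * Λ)ᴴ by rw [conjTranspose_sub, conjTranspose_mul, hΛh],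
    trace_conjTranspose_mul_eq_sum]
  simp only [Complex.re_sum]
  refine Finset.sum_congr rfl fun i _ => Finset.sum_congr rfl fun j _ => ?_
  simp only [hΛ, Matrix.sub_apply, mul_diagonal, diagonal_mul]
  simp [Complex.normSq_apply]
  ring

/-- The deviation of `∂ρ` from the value which the vanishing of the Laplacian forces on it. -/
def gradDefect (a r : Fin n → Matrix (Fin n) (Fin n) ℂ) (k i j : Fin n) : ℂ :=
  r k i j - (1 / 2 : ℝ) * ((lam i + lam j - lam k : ℝ) * a k i j
    + (lam k + lam j - lam i : ℝ) * a i k j)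

/-- The symmetrization in `k`, `i` of the terms of the Bochner formula which are quadratic in first
derivatives. -/
theorem bochner_pointwise (lk li lj : ℝ) (a b r : ℂ) :
    ((Complex.normSq r - (li + lj) * (r * star a).re + li * lj * Complex.normSq a)
      + (-(li + lj) * (r * star a).re + (li ^ 2 + lj ^ 2) * Complex.normSq a)
      - (lk * (-2 * (r * star a).re) + lk * ((li + lj) * Complex.normSq a))
      - Complex.normSq a * (li ^ 2 - li * lk)
      + Complex.normSq (a - b) * (lk ^ 2 - lk * lj)
      - Complex.normSq (r - (1 / 2 : ℝ) * ((li + lj - lk : ℝ) * a + (lk + lj - li : ℝ) * b))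
      - 1 / 4 * (li + lk - lj) ^ 2 * Complex.normSq (a - b)) +
    ((Complex.normSq r - (lk + lj) * (r * star b).re + lk * lj * Complex.normSq b)
      + (-(lk + lj) * (r * star b).re + (lk ^ 2 + lj ^ 2) * Complex.normSq b)
      - (li * (-2 * (r * star b).re) + li * ((lk + lj) * Complex.normSq b))
      - Complex.normSq b * (lk ^ 2 - lk * li)
      + Complex.normSq (b - a) * (li ^ 2 - li * lj)
      - Complex.normSq (r - (1 / 2 : ℝ) * ((lk + lj - li : ℝ) * b + (li + lj - lk : ℝ) * a))
      - 1 / 4 * (lk + li - lj) ^ 2 * Complex.normSq (b - a)) = 0 := by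
  -- The `r`-dependent part of the sum of the first two lines of both halves is `2|r|² - 2 Re (r
  -- c̄)` with `c = (li + lj - lk) a + (lk + lj - li) b`. Completing the square gives the centre `c
  -- / 2`, and the leftover in `a`, `b` is absorbed by the torsion terms.
  simp only [Complex.normSq_apply, Complex.sub_re, Complex.sub_im, Complex.add_re, Complex.add_im,
    Complex.mul_re, Complex.mul_im, Complex.ofReal_re, Complex.ofReal_im, Complex.star_def,
    Complex.conj_re, Complex.conj_im]
  ring

/-- The algebraic part of the Bochner formula. -/
theorem bochner_algebra (a a₂ r r₂ : Fin n → Matrix (Fin n) (Fin n) ℂ)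
    (hr : ∀ k i j, r k i j = r i k j) (hr₂ : ∀ k i, r₂ k i i = r₂ i k k)
    (htr : ∀ k, (endoHess (diagonal fun i => (lam i : ℂ)) (a k) (a₂ k) (r k) (r₂ k)).trace = 0) :
    ∑ k, ((((r k)ᴴ - diagonal (fun i => (lam i : ℂ)) * (a k)ᴴ) *
        (r k - diagonal (fun i => (lam i : ℂ)) * a k)).trace.re
      + (diagonal (fun i => (lam i : ℂ)) *
        endoHess (diagonal fun i => (lam i : ℂ)) (a k) (a₂ k) (r k) (r₂ k)).trace.re) =
    ∑ k, ∑ m, (-(a₂ m k k).re + ∑ p, Complex.normSq (a m k p)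
        - ∑ p, Complex.normSq (a k p m - a p k m)) * (lam k ^ 2 - lam k * lam m)
      + ∑ k, ∑ i, ∑ j, Complex.normSq (gradDefect lam a r k i j)
      + ∑ k, ∑ i, ∑ j, (1 / 4) * (lam i + lam k - lam j) ^ 2
        * Complex.normSq (a k i j - a i k j) := by
  -- The vanishing trace is weighted by the eigenvalue of the direction of differentiation.
  -- Subtracting it turns `λ_i r₂` into `(λ_i - λ_k) r₂` and `-λ_i² a₂` into `-(λ_i² - λ_i λ_k) a₂`,
  -- the weight occurring in `Q`-nonnegativity.
  have h1 : ∀ k, lam k * (endoHess (diagonal fun i => (lam i : ℂ)) (a k) (a₂ k) (r k)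
      (r₂ k)).trace.re = 0 := fun k => by rw [htr]; simp
  have h2 : ∑ k, ∑ m, (-(a₂ m k k).re + ∑ p, Complex.normSq (a m k p)
        - ∑ p, Complex.normSq (a k p m - a p k m)) * (lam k ^ 2 - lam k * lam m) =
      ∑ k, ∑ i, -((a₂ k i i).re * (lam i ^ 2 - lam i * lam k))
      + ∑ k, ∑ i, ∑ j, Complex.normSq (a k i j) * (lam i ^ 2 - lam i * lam k)
      - ∑ k, ∑ i, ∑ j, Complex.normSq (a k i j - a i k j) * (lam k ^ 2 - lam k * lam j) := by
    have e : ∑ k, ∑ i, ∑ j, Complex.normSq (a k i j - a i k j) * (lam k ^ 2 - lam k * lam j) =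
        ∑ k, ∑ m, ∑ p, Complex.normSq (a k p m - a p k m) * (lam k ^ 2 - lam k * lam m) :=
      Finset.sum_congr rfl fun k _ => Finset.sum_comm
    rw [e, Finset.sum_comm (f := fun k i => -((a₂ k i i).re * (lam i ^ 2 - lam i * lam k))),
      Finset.sum_comm (f := fun k i => ∑ j, Complex.normSq (a k i j) * (lam i ^ 2 - lam i * lam k))]
    simp only [← Finset.sum_sub_distrib, ← Finset.sum_add_distrib]
    refine Finset.sum_congr rfl fun k _ => Finset.sum_congr rfl fun m _ => ?_
    simp only [← Finset.sum_mul]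
    ring
  have h3 := Finset.sum_eq_zero fun k (_ : k ∈ Finset.univ) => h1 k
  have h5 : ∀ x y s : ℝ, s = 0 → x - y - s = 0 → x = y := fun x y s _ _ => by linarith
  rw [h2]
  refine h5 _ _ _ h3 ?_
  clear h5 h1 h2 h3 htr
  simp only [trace_grad_sq, trace_diagonal_mul_endoHess, trace_endoHess, mul_add, Finset.mul_sum]
  simp only [← Finset.sum_sub_distrib, ← Finset.sum_add_distrib]
  refine sum_eq_zero_of_antisymm fun k i => ?_
  have h4 : (r₂ k i i).re = (r₂ i k k).re := by rw [hr₂]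
  have key := Finset.sum_eq_zero fun j (_ : j ∈ Finset.univ) =>
    bochner_pointwise (lam k) (lam i) (lam j) (a k i j) (a i k j) (r k i j)
  simp only [Finset.sum_sub_distrib, Finset.sum_add_distrib] at key
  simp only [gradDefect, hr i k, Finset.sum_sub_distrib, Finset.sum_add_distrib] at key ⊢
  -- The second derivatives of `P` carry the antisymmetric factor `λ_i - λ_k`, so their symmetry in
  -- `i`, `k` cancels them.
  linear_combination key + (lam i - lam k) * h4

end Algebra

section Analysis

variable {n : ℕ} {U : Set (Cn n)} {G P : Cn n → Matrix (Fin n) (Fin n) ℂ} {y : Cn n}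
  {lam : Fin n → ℝ} {s : ℂ} {k : Fin n}

theorem wirtMat_mul_inv (hU : IsOpen U) (hG : SmoothMatOn G U) (hP : SmoothMatOn P U)
    (hdet : ∀ z ∈ U, (G z).det ≠ 0) {z : Cn n} (hz : z ∈ U) :
    wirtMat s k (fun z => P z * (G z)⁻¹) z =
      wirtMat s k P z * (G z)⁻¹ - P z * (G z)⁻¹ * wirtMat s k G z * (G z)⁻¹ := by
  rw [wirtMat_mul hU hP (hG.inv hdet) hz, wirtMat_inv hU hG hdet hz]
  simp only [mul_neg, Matrix.mul_assoc, sub_eq_add_neg]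

/-- Hermitian symmetry reduces barred first derivatives to unbarred ones, so that only `a = ∂G` and
`r = ∂P` remain in the algebra. -/
theorem wirtMat_eq_conjTranspose (hU : IsOpen U) (hG : SmoothMatOn G U)
    (hh : ∀ z ∈ U, (G z).IsHermitian) (hy : y ∈ U) :
    wirtMat Complex.I k G y = (wirtMat (-Complex.I) k G y)ᴴ := by
  rw [← star_wirtMat_apply hU hG hh hy]
  simp

theorem wirtMat_wirtMat_mul_inv (hU : IsOpen U) (hG : SmoothMatOn G U) (hP : SmoothMatOn P U)
    (hdet : ∀ z ∈ U, (G z).det ≠ 0) (hGh : ∀ z ∈ U, (G z).IsHermitian)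
    (hPh : ∀ z ∈ U, (P z).IsHermitian) (hy : y ∈ U) (hGy : G y = 1)
    (hPy : P y = diagonal fun i => (lam i : ℂ)) :
    wirtMat Complex.I k (wirtMat (-Complex.I) k fun z => P z * (G z)⁻¹) y =
      endoHess (diagonal fun i => (lam i : ℂ)) (wirtMat (-Complex.I) k G y)
        (wirtMat Complex.I k (wirtMat (-Complex.I) k G) y) (wirtMat (-Complex.I) k P y)
        (wirtMat Complex.I k (wirtMat (-Complex.I) k P) y) := by
  have hK := hG.inv hdet
  have hGk := hG.wirtMat (s := -Complex.I) (i := k) hU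
  have hPk := hP.wirtMat (s := -Complex.I) (i := k) hU
  rw [wirtMat_congr (G := fun z => wirtMat (-Complex.I) k P z * (G z)⁻¹
      - P z * (G z)⁻¹ * wirtMat (-Complex.I) k G z * (G z)⁻¹)
      (by filter_upwards [hU.mem_nhds hy] with z hz using wirtMat_mul_inv hU hG hP hdet hz),
    wirtMat_sub hU (hPk.mul hK) (((hP.mul hK).mul hGk).mul hK) hy, wirtMat_mul hU hPk hK hy,
    wirtMat_mul hU ((hP.mul hK).mul hGk) hK hy, wirtMat_mul hU (hP.mul hK) hGk hy,
    wirtMat_mul_inv hU hG hP hdet hy, wirtMat_inv hU hG hdet hy,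
    wirtMat_eq_conjTranspose hU hG hGh hy, wirtMat_eq_conjTranspose hU hP hPh hy, hGy, hPy,
    endoHess]
  simp only [inv_one, mul_one, one_mul]
  noncomm_ring

theorem wirt_wirt_trace_sq {H : Cn n → Matrix (Fin n) (Fin n) ℂ} (hU : IsOpen U)
    (hH : SmoothMatOn H U) (hy : y ∈ U) {t : ℂ} :
    wirt t k (wirt s k fun z => (H z * H z).trace) y =
      2 * ((wirtMat t k H y * wirtMat s k H y).trace
        + (H y * wirtMat t k (wirtMat s k H) y).trace) := by
  have hHk := hH.wirtMat (s := s) (i := k) hU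
  have h1 : ∀ z ∈ U, wirt s k (fun z => (H z * H z).trace) z =
      2 * (H z * wirtMat s k H z).trace := fun z hz => by
    rw [wirt_trace hU (hH.mul hH) hz, wirtMat_mul hU hH hH hz, trace_add,
      trace_mul_comm (wirtMat s k H z)]
    ring
  rw [wirt_congr (g := fun z => 2 * (H z * wirtMat s k H z).trace)
      (by filter_upwards [hU.mem_nhds hy] with z hz using h1 z hz),
    wirt_const_mul _ (differentiableAt_of_smoothOn hU (hH.mul hHk).trace hy),
    wirt_trace hU (hH.mul hHk) hy, wirtMat_mul hU hH hHk hy, trace_add]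

/-- This is how the constancy of `g^{i j̄} ρ_{i j̄}` enters the Bochner formula. -/
theorem wirt_wirt_trace_eq_zero {H : Cn n → Matrix (Fin n) (Fin n) ℂ} (hU : IsOpen U)
    (hH : SmoothMatOn H U) (hy : y ∈ U) {t c : ℂ} (hc : ∀ z ∈ U, (H z).trace = c) :
    (wirtMat t k (wirtMat s k H) y).trace = 0 := by
  have h1 : ∀ z ∈ U, (wirtMat s k H z).trace = 0 := fun z hz => by
    rw [← wirt_trace hU hH hz, wirt_congr (g := fun _ => c)
      (by filter_upwards [hU.mem_nhds hz] with w hw using hc w hw), wirt_const]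
  rw [← wirt_trace hU (hH.wirtMat hU) hy, wirt_congr (g := fun _ => 0)
      (by filter_upwards [hU.mem_nhds hy] with w hw using h1 w hw), wirt_const]

/-- Closedness exchanges an unbarred derivative with the first index and, by conjugation, a barred
derivative with the second. Applying both, with the derivatives commuted in between, exchanges `k`
and `i` completely. -/
theorem wirt_wirt_diag_symm (hU : IsOpen U) (hP : SmoothMatOn P U)
    (hPh : ∀ z ∈ U, (P z).IsHermitian)
    (hclosed : ∀ z ∈ U, ∀ k i j, wirtMat (-Complex.I) k P z i j = wirtMat (-Complex.I) i P z k j)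
    (hy : y ∈ U) (k i : Fin n) :
    wirtMat Complex.I k (wirtMat (-Complex.I) k P) y i i =
      wirtMat Complex.I i (wirtMat (-Complex.I) i P) y k k := by
  have hclosed' : ∀ z ∈ U, ∀ k i j,
      wirtMat Complex.I k P z i j = wirtMat Complex.I j P z i k := fun z hz k i j => by
    rw [wirtMat_eq_conjTranspose hU hP hPh hz, wirtMat_eq_conjTranspose hU hP hPh hz,
      conjTranspose_apply, conjTranspose_apply, hclosed z hz]
  calc wirt Complex.I k (fun z => wirtMat (-Complex.I) k P z i i) y
      = wirt Complex.I k (fun z => wirtMat (-Complex.I) i P z k i) y :=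
        wirt_congr (by filter_upwards [hU.mem_nhds hy] with z hz using hclosed z hz k i i)
    _ = wirt (-Complex.I) i (fun z => wirtMat Complex.I k P z k i) y := wirt_comm hU (hP k i) hy
    _ = wirt (-Complex.I) i (fun z => wirtMat Complex.I i P z k k) y :=
        wirt_congr (by filter_upwards [hU.mem_nhds hy] with z hz using hclosed' z hz k k i)
    _ = wirt Complex.I i (fun z => wirtMat (-Complex.I) i P z k k) y :=
        (wirt_comm hU (hP k k) hy).symm

/-- The Bochner formula for `|ρ|² = tr (P G⁻¹)²` at a point with `G = 1` and `P` diagonal. -/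
theorem bochner_formula (hU : IsOpen U) (hG : SmoothMatOn G U) (hP : SmoothMatOn P U)
    (hdet : ∀ z ∈ U, (G z).det ≠ 0) (hGh : ∀ z ∈ U, (G z).IsHermitian)
    (hPh : ∀ z ∈ U, (P z).IsHermitian)
    (hclosed : ∀ z ∈ U, ∀ k i j, wirtMat (-Complex.I) k P z i j = wirtMat (-Complex.I) i P z k j)
    {c : ℂ} (hc : ∀ z ∈ U, (P z * (G z)⁻¹).trace = c)
    (hy : y ∈ U) (hGy : G y = 1) (hPy : P y = diagonal fun i => (lam i : ℂ))
    {a : Fin n → Matrix (Fin n) (Fin n) ℂ} (ha : ∀ k, a k = wirtMat (-Complex.I) k G y) :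
    ∑ k, (wirt Complex.I k (wirt (-Complex.I) k fun z =>
        (P z * (G z)⁻¹ * (P z * (G z)⁻¹)).trace) y).re =
    2 * (∑ k, ∑ m, (-(wirtMat Complex.I m (wirtMat (-Complex.I) m G) y k k).re
          + ∑ p, Complex.normSq (a m k p) - ∑ p, Complex.normSq (a k p m - a p k m))
          * (lam k ^ 2 - lam k * lam m)
      + ∑ k, ∑ i, ∑ j, Complex.normSq
        (gradDefect lam a (fun k => wirtMat (-Complex.I) k P y) k i j)
      + ∑ k, ∑ i, ∑ j, (1 / 4) * (lam i + lam k - lam j) ^ 2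
        * Complex.normSq (a k i j - a i k j)) := by
  obtain rfl : a = fun k => wirtMat (-Complex.I) k G y := funext ha
  have hH := hP.mul (hG.inv hdet)
  have hess := fun k => wirtMat_wirtMat_mul_inv (k := k) hU hG hP hdet hGh hPh hy hGy hPy
  rw [← bochner_algebra lam (fun k => wirtMat (-Complex.I) k G y)
    (fun k => wirtMat Complex.I k (wirtMat (-Complex.I) k G) y)
    (fun k => wirtMat (-Complex.I) k P y)
    (fun k => wirtMat Complex.I k (wirtMat (-Complex.I) k P) y) (hclosed y hy)
    (fun k i => wirt_wirt_diag_symm hU hP hPh hclosed hy k i)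
    (fun k => by rw [← hess k]; exact wirt_wirt_trace_eq_zero hU hH hy hc), Finset.mul_sum]
  refine Finset.sum_congr rfl fun k _ => ?_
  rw [wirt_wirt_trace_sq hU hH hy, hess, wirtMat_mul_inv hU hG hP hdet hy,
    wirtMat_mul_inv hU hG hP hdet hy, wirtMat_eq_conjTranspose hU hG hGh hy,
    wirtMat_eq_conjTranspose hU hP hPh hy, hGy, hPy]
  simp only [inv_one, mul_one]
  rw [show (2 : ℂ) = ((2 : ℝ) : ℂ) by norm_num, Complex.re_ofReal_mul, Complex.add_re]

end Analysis

end HermitianGeometry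

end

/-! ### Linear algebra of invariant real forms, congruence and simultaneous diagonalization. -/

noncomputable section

namespace HermitianGeometry

open Topology Matrix
open scoped ComplexOrder

section Sesquilinear

/-- A real bilinear form, invariant under multiplication by `√-1`. -/
structure IsInvariantForm {V : Type*} [AddCommGroup V] [Module ℂ V] (B : V → V → ℝ) : Prop where
  add_left : ∀ u u' v, B (u + u') v = B u v + B u' v
  add_right : ∀ u v v', B u (v + v') = B u v + B u v'
  smul_left : ∀ (r : ℝ) u v, B ((r : ℂ) • u) v = r * B u v
  smul_right : ∀ (r : ℝ) u v, B u ((r : ℂ) • v) = r * B u v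
  invariant : ∀ u v, B (Complex.I • u) (Complex.I • v) = B u v

namespace IsInvariantForm

variable {V : Type*} [AddCommGroup V] [Module ℂ V] {B : V → V → ℝ}

theorem neg_right (hB : IsInvariantForm B) (u v : V) : B u (-v) = -B u v := by
  have := hB.smul_right (-1) u v
  simpa using this

theorem I_smul_left (hB : IsInvariantForm B) (u v : V) :
    B (Complex.I • u) v = -B u (Complex.I • v) := by
  rw [← hB.invariant u (Complex.I • v), smul_smul, Complex.I_mul_I, neg_smul, one_smul,
    hB.neg_right, neg_neg]

/-- Invariance moves `√-1` from the first argument to the second, so the four real values in `mixed`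
collapse to two. Sesquilinearity is read off from this form. -/
theorem mixed_eq (hB : IsInvariantForm B) (u v : V) :
    mixed B u v = (1 / 2 : ℂ) * (B u v + Complex.I * B u (Complex.I • v)) := by
  rw [mixed, hB.invariant, hB.I_smul_left]
  push_cast
  ring

theorem mixed_add_left (hB : IsInvariantForm B) (u u' v : V) :
    mixed B (u + u') v = mixed B u v + mixed B u' v := by
  simp only [hB.mixed_eq, hB.add_left]
  push_cast
  ring

theorem mixed_add_right (hB : IsInvariantForm B) (u v v' : V) :
    mixed B u (v + v') = mixed B u v + mixed B u v' := by
  simp only [hB.mixed_eq, hB.add_right, smul_add]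
  push_cast
  ring

theorem smul_eq (c : ℂ) (u : V) :
    c • u = ((c.re : ℝ) : ℂ) • u + ((c.im : ℝ) : ℂ) • (Complex.I • u) := by
  rw [smul_smul, ← add_smul, Complex.re_add_im]

theorem mixed_smul_left (hB : IsInvariantForm B) (c : ℂ) (u v : V) :
    mixed B (c • u) v = c * mixed B u v := by
  have h : B u (Complex.I • Complex.I • v) = -B u v := by
    rw [smul_smul, Complex.I_mul_I, neg_smul, one_smul, hB.neg_right]
  rw [smul_eq c u]
  simp only [hB.mixed_eq, hB.add_left, hB.smul_left, hB.I_smul_left, h]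
  conv_rhs => rw [← Complex.re_add_im c]
  push_cast
  linear_combination (1 / 2 : ℂ) * c.im * (-B u (Complex.I • v)) * Complex.I_mul_I

theorem mixed_smul_right (hB : IsInvariantForm B) (c : ℂ) (u v : V) :
    mixed B u (c • v) = star c * mixed B u v := by
  have h : B u (Complex.I • Complex.I • v) = -B u v := by
    rw [smul_smul, Complex.I_mul_I, neg_smul, one_smul, hB.neg_right]
  have h' : ∀ r : ℝ, ∀ w, B u (Complex.I • (r : ℂ) • w) = r * B u (Complex.I • w) := by
    intro r w
    rw [smul_comm, hB.smul_right]
  rw [smul_eq c v]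
  simp only [hB.mixed_eq, hB.add_right, smul_add, hB.smul_right, h', h]
  have hc : star c = c.re - c.im * Complex.I := by
    apply Complex.ext <;> simp
  rw [hc]
  push_cast
  linear_combination (1 / 2 : ℂ) * c.im * (B u (Complex.I • v)) * Complex.I_mul_I

theorem mixed_sum_smul_left (hB : IsInvariantForm B) {ι : Type*} (S : Finset ι) (c : ι → ℂ)
    (u : ι → V) (v : V) : mixed B (∑ a ∈ S, c a • u a) v = ∑ a ∈ S, c a * mixed B (u a) v := by
  refine (map_sum (AddMonoidHom.mk' (fun u => mixed B u v) fun u u' => hB.mixed_add_left u u' v)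
    (fun a => c a • u a) S).trans (Finset.sum_congr rfl fun a _ => ?_)
  exact hB.mixed_smul_left _ _ _

theorem mixed_sum_smul_right (hB : IsInvariantForm B) {ι : Type*} (S : Finset ι) (c : ι → ℂ)
    (v : ι → V) (u : V) :
    mixed B u (∑ a ∈ S, c a • v a) = ∑ a ∈ S, star (c a) * mixed B u (v a) := by
  refine (map_sum (AddMonoidHom.mk' (fun v => mixed B u v) fun v v' => hB.mixed_add_right u v v')
    (fun a => c a • v a) S).trans (Finset.sum_congr rfl fun a _ => ?_)
  exact hB.mixed_smul_right _ _ _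

theorem comp {W : Type*} [AddCommGroup W] [Module ℂ W] (hB : IsInvariantForm B) (T : W →ₗ[ℂ] V) :
    IsInvariantForm fun u v => B (T u) (T v) where
  add_left u u' v := by simp [hB.add_left]
  add_right u u' v := by simp [hB.add_right]
  smul_left r u v := by rw [map_smul, hB.smul_left]
  smul_right r u v := by rw [map_smul, hB.smul_right]
  invariant u v := by rw [map_smul, map_smul, hB.invariant]

theorem mixed_symm (hB : IsInvariantForm B) (h : ∀ u v, B u v = B v u) (u v : V) :
    mixed B v u = star (mixed B u v) := by
  have h1 : B v (Complex.I • u) = -B u (Complex.I • v) := by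
    rw [h v, hB.I_smul_left]
  rw [hB.mixed_eq, hB.mixed_eq, h v u, h1]
  simp

/-- An alternating invariant form gives a skew-Hermitian matrix; the factor `-√-1` makes it
Hermitian, which is why `(ρ_{k j̄})` has real eigenvalues with respect to `g`. -/
theorem mixed_antisymm (hB : IsInvariantForm B) (h : ∀ u v, B u v = -B v u) (u v : V) :
    -Complex.I * mixed B v u = star (-Complex.I * mixed B u v) := by
  have h1 : B v (Complex.I • u) = B u (Complex.I • v) := by
    rw [h v, hB.I_smul_left, neg_neg]
  rw [hB.mixed_eq, hB.mixed_eq, h v u, h1]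
  simp
  ring

theorem mixed_self (hB : IsInvariantForm B) (h : ∀ u v, B u v = B v u) (u : V) :
    mixed B u u = (B u u / 2 : ℝ) := by
  have h1 : B u (Complex.I • u) = 0 := by
    have := hB.I_smul_left u u
    rw [h] at this
    linarith
  rw [hB.mixed_eq, h1]
  push_cast
  ring

end IsInvariantForm

variable {n : ℕ}

theorem eq_sum_stdVec (u : Cn n) : u = ∑ a, u a • stdVec a := by
  ext i
  simp [stdVec, Pi.single_apply]

theorem mixed_map {V W : Type*} [AddCommGroup V] [Module ℂ V] [AddCommGroup W] [Module ℂ W]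
    (B : V → V → ℝ) (T : W →ₗ[ℂ] V) (u v : W) :
    mixed (fun u v => B (T u) (T v)) u v = mixed B (T u) (T v) := by
  simp only [mixed, map_smul]

/-- The matrix of the sesquilinear form determined by an invariant real bilinear form. -/
def mixedMat (B : Cn n → Cn n → ℝ) : Matrix (Fin n) (Fin n) ℂ :=
  of fun i j => mixed B (stdVec i) (stdVec j)

/-- The matrix of a linear endomorphism of `ℂⁿ`. -/
def linMat (T : Cn n →ₗ[ℂ] Cn n) : Matrix (Fin n) (Fin n) ℂ := of fun a i => T (stdVec i) a

theorem linMat_mulVec (T : Cn n →ₗ[ℂ] Cn n) (v : Cn n) (a : Fin n) :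
    (linMat T *ᵥ v) a = T v a := by
  conv_rhs => rw [eq_sum_stdVec v, map_sum]
  simp only [mulVec, dotProduct, linMat, of_apply, map_smul]
  simp [mul_comm]

theorem det_linMat_ne_zero {T : Cn n →ₗ[ℂ] Cn n} (hT : Function.Injective T) :
    (linMat T).det ≠ 0 := by
  intro h
  obtain ⟨v, hv, hv0⟩ := exists_mulVec_eq_zero_iff.2 h
  apply hv
  have h1 : T (WithLp.toLp 2 v) = 0 := by
    ext a
    rw [← linMat_mulVec]
    exact congrFun hv0 a
  have h2 := hT (h1.trans (map_zero T).symm)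
  simpa using h2

theorem mixed_eq_sum {B : Cn n → Cn n → ℝ} (hB : IsInvariantForm B) (u v : Cn n) :
    mixed B u v = ∑ i, ∑ j, u i * star (v j) * mixedMat B i j := by
  conv_lhs => rw [eq_sum_stdVec u, eq_sum_stdVec v]
  simp only [hB.mixed_sum_smul_left, hB.mixed_sum_smul_right, Finset.mul_sum, mixedMat, of_apply,
    mul_assoc]

theorem mixedMat_comp {B : Cn n → Cn n → ℝ} (hB : IsInvariantForm B) (T : Cn n →ₗ[ℂ] Cn n) :
    mixedMat (fun u v => B (T u) (T v)) = (linMat T)ᵀ * mixedMat B * (linMat T).map star := by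
  ext i j
  rw [mixedMat, of_apply, mixed_map, mixed_eq_sum hB]
  simp only [mul_apply, transpose_apply, map_apply, linMat, of_apply, Finset.sum_mul]
  rw [Finset.sum_comm]
  refine Finset.sum_congr rfl fun a _ => Finset.sum_congr rfl fun b _ => ?_
  ring

theorem mixedMat_posDef {B : Cn n → Cn n → ℝ} (hB : IsInvariantForm B)
    (hs : ∀ u v, B u v = B v u) (hpos : ∀ u, u ≠ 0 → 0 < B u u) : (mixedMat B).PosDef := by
  rw [posDef_iff_dotProduct_mulVec]
  refine ⟨IsHermitian.ext fun i j => (hB.mixed_symm hs _ _).symm, fun x hx => ?_⟩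
  -- `mixed` is linear in the first argument and conjugate linear in the second, while `star x ⬝ᵥ A
  -- *ᵥ x` conjugates the first; hence the conjugate vector.
  set u : Cn n := WithLp.toLp 2 (star x) with hu
  have hu0 : u ≠ 0 := by
    intro h
    apply hx
    have h1 : star x = 0 := by simpa [hu] using h
    simpa using h1
  have h1 : star x ⬝ᵥ mixedMat B *ᵥ x = mixed B u u := by
    rw [mixed_eq_sum hB]
    simp only [dotProduct, mulVec, Finset.mul_sum]
    refine Finset.sum_congr rfl fun a _ => Finset.sum_congr rfl fun b _ => ?_
    simp [hu]
    ring
  rw [h1, hB.mixed_self hs]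
  exact_mod_cast half_pos (hpos u hu0)

end Sesquilinear

section Congruence

variable {n : ℕ}

/-- Two sesquilinear forms change by the same congruence, so `P G⁻¹` changes by a similarity: the
conjugate factors cancel. Traces of its powers are therefore independent of coordinates. -/
theorem mul_inv_congruence {M G P : Matrix (Fin n) (Fin n) ℂ} (hM : M.det ≠ 0) :
    (Mᵀ * P * M.map star) * (Mᵀ * G * M.map star)⁻¹ = Mᵀ * (P * G⁻¹) * Mᵀ⁻¹ := by
  have h2 : IsUnit (M.map star).det := by
    rw [isUnit_iff_ne_zero, ← conjTranspose_transpose, det_transpose, det_conjTranspose]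
    simpa using hM
  rw [Matrix.mul_inv_rev, Matrix.mul_inv_rev]
  calc Mᵀ * P * M.map star * ((M.map star)⁻¹ * (G⁻¹ * Mᵀ⁻¹))
      = Mᵀ * P * (M.map star * (M.map star)⁻¹) * G⁻¹ * Mᵀ⁻¹ := by simp only [Matrix.mul_assoc]
    _ = _ := by rw [mul_nonsing_inv _ h2]; simp only [Matrix.mul_assoc, Matrix.one_mul]

theorem trace_sq_congruence {M G P : Matrix (Fin n) (Fin n) ℂ} (hM : M.det ≠ 0) :
    ((Mᵀ * P * M.map star) * (Mᵀ * G * M.map star)⁻¹ *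
      ((Mᵀ * P * M.map star) * (Mᵀ * G * M.map star)⁻¹)).trace =
      (P * G⁻¹ * (P * G⁻¹)).trace := by
  have h1 : IsUnit Mᵀ.det := by rwa [det_transpose, isUnit_iff_ne_zero]
  rw [mul_inv_congruence hM]
  rw [show Mᵀ * (P * G⁻¹) * Mᵀ⁻¹ * (Mᵀ * (P * G⁻¹) * Mᵀ⁻¹) =
    Mᵀ * (P * G⁻¹ * (Mᵀ⁻¹ * Mᵀ) * (P * G⁻¹)) * Mᵀ⁻¹ by simp only [Matrix.mul_assoc],
    nonsing_inv_mul _ h1, Matrix.mul_one, trace_mul_comm, ← Matrix.mul_assoc,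
    nonsing_inv_mul _ h1, Matrix.one_mul]

/-- Simultaneous diagonalization of a positive definite and a Hermitian form. -/
theorem exists_simultaneous_diagonalization {G P : Matrix (Fin n) (Fin n) ℂ} (hG : G.PosDef)
    (hP : P.IsHermitian) : ∃ M : Matrix (Fin n) (Fin n) ℂ, ∃ lam : Fin n → ℝ, M.det ≠ 0 ∧
      Mᵀ * G * M.map star = 1 ∧ Mᵀ * P * M.map star = diagonal fun i => (lam i : ℂ) := by
  obtain ⟨N, hN⟩ : ∃ N : Matrix (Fin n) (Fin n) ℂ, Nᴴ * G * N = 1 := by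
    set V : Matrix (Fin n) (Fin n) ℂ := hG.1.eigenvectorUnitary.1 with hV
    have hVV : Vᴴ * V = 1 := by
      have := Unitary.star_mul_self_of_mem hG.1.eigenvectorUnitary.2
      rwa [star_eq_conjTranspose] at this
    have hspec : G = V * diagonal (fun i => (hG.1.eigenvalues i : ℂ)) * Vᴴ := by
      have := hG.1.spectral_theorem
      rw [Unitary.conjStarAlgAut_apply, star_eq_conjTranspose] at this
      exact this
    set D : Matrix (Fin n) (Fin n) ℂ :=
      -- Rescaling the orthonormal eigenvectors of `G` by the inverse square roots of its
      -- eigenvalues makes them `G`-orthonormal; a unitary change then diagonalizes `P` without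
      -- disturbing this.
      diagonal fun i => (((Real.sqrt (hG.1.eigenvalues i))⁻¹ : ℝ) : ℂ) with hD
    refine ⟨V * D, ?_⟩
    have hDh : Dᴴ = D := by
      rw [hD, diagonal_conjTranspose]; congr 1; ext i; simp
    rw [conjTranspose_mul, hDh, hspec]
    rw [show D * Vᴴ * (V * diagonal (fun i => (hG.1.eigenvalues i : ℂ)) * Vᴴ) * (V * D) =
      D * (Vᴴ * V) * diagonal (fun i => (hG.1.eigenvalues i : ℂ)) * (Vᴴ * V) * D by
        simp only [Matrix.mul_assoc], hVV, Matrix.mul_one, Matrix.mul_one, hD,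
      diagonal_mul_diagonal, diagonal_mul_diagonal, ← diagonal_one]
    congr 1
    ext i
    have h1 : 0 < hG.1.eigenvalues i := hG.eigenvalues_pos i
    have h2 : (Real.sqrt (hG.1.eigenvalues i))⁻¹ * hG.1.eigenvalues i *
        (Real.sqrt (hG.1.eigenvalues i))⁻¹ = 1 := by
      have h3 : Real.sqrt (hG.1.eigenvalues i) ≠ 0 := (Real.sqrt_pos.2 h1).ne'
      field_simp
      rw [Real.sq_sqrt h1.le]
    exact_mod_cast h2
  have hP' : (Nᴴ * P * N).IsHermitian := isHermitian_conjTranspose_mul_mul N hP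
  set V : Matrix (Fin n) (Fin n) ℂ := hP'.eigenvectorUnitary.1 with hV
  have hVV : Vᴴ * V = 1 := by
    have := Unitary.star_mul_self_of_mem hP'.eigenvectorUnitary.2
    rwa [star_eq_conjTranspose] at this
  have hspec : Nᴴ * P * N = V * diagonal (fun i => (hP'.eigenvalues i : ℂ)) * Vᴴ := by
    have := hP'.spectral_theorem
    rw [Unitary.conjStarAlgAut_apply, star_eq_conjTranspose] at this
    exact this
  set W := N * V with hW
  have hWG : Wᴴ * G * W = 1 := by
    rw [hW, conjTranspose_mul, show Vᴴ * Nᴴ * G * (N * V) = Vᴴ * (Nᴴ * G * N) * V by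
      simp only [Matrix.mul_assoc], hN, Matrix.mul_one, hVV]
  have hWP : Wᴴ * P * W = diagonal fun i => (hP'.eigenvalues i : ℂ) := by
    rw [hW, conjTranspose_mul, show Vᴴ * Nᴴ * P * (N * V) = Vᴴ * (Nᴴ * P * N) * V by
      simp only [Matrix.mul_assoc]]
    refine (congrArg (fun X => Vᴴ * X * V) hspec).trans ?_
    have h : ∀ D : Matrix (Fin n) (Fin n) ℂ, Vᴴ * (V * D * Vᴴ) * V = D := fun D => by
      rw [show Vᴴ * (V * D * Vᴴ) * V = (Vᴴ * V) * D * (Vᴴ * V) by simp only [Matrix.mul_assoc],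
        hVV, Matrix.mul_one, Matrix.one_mul]
    exact h _
  have hT : (W.map star)ᵀ = Wᴴ := rfl
  have hS : (W.map star).map star = W := by ext; simp
  -- A coordinate change acts by `Mᵀ · M̄` rather than `Wᴴ · W`, so `M` is the entrywise conjugate
  -- of `W`.
  refine ⟨W.map star, hP'.eigenvalues, ?_, by rw [hT, hS, hWG], by rw [hT, hS, hWP]⟩
  intro h
  have h1 := congrArg det hWG
  rw [det_mul, det_mul, ← hT, det_transpose, h] at h1
  simp at h1

end Congruence

end HermitianGeometry

end

/-! ### The matrices of `g` and `ρ` in holomorphic charts, and closedness in components. -/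

noncomputable section

namespace HermitianGeometry

open Topology Matrix
open scoped ComplexOrder

section Chart

variable {n : ℕ} {X : Type*} [TopologicalSpace X] [ChartedSpace (Cn n) X]

/-- The metric at a point, as a bilinear form on `ℂⁿ = T_x X`. -/
def HermitianMetric.form (g : HermitianMetric n X) (x : X) (u v : Cn n) : ℝ :=
  g.val x u v

/-- The two-form `ρ` at a point, as a bilinear form on `ℂⁿ = T_x X`. -/
def RealOneOneForm.form (ρ : RealOneOneForm n X) (x : X) (u v : Cn n) : ℝ :=
  ρ.val x ![u, v]

/-- The differential of the inverse of a chart, as an endomorphism of `ℂⁿ`. -/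
def dSymmLin (e : OpenPartialHomeomorph X (Cn n)) (y : Cn n) : Cn n →ₗ[ℂ] Cn n :=
  (dSymm e y : Cn n →L[ℂ] Cn n).toLinearMap

theorem HermitianMetric.isInvariantForm (g : HermitianMetric n X) (x : X) :
    IsInvariantForm (g.form x) where
  add_left u u' v := by
    have := LinearMap.congr_fun ((g.val x).map_add (u : Tan n x) (u' : Tan n x))
      (v : Tan n x)
    exact this
  add_right u v v' := (g.val x (u : Tan n x)).map_add _ _
  smul_left r u v := by
    have := LinearMap.congr_fun ((g.val x).map_smul r (u : Tan n x)) (v : Tan n x)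
    exact this
  smul_right r u v := (g.val x (u : Tan n x)).map_smul r _
  invariant u v := g.compat x _ _

theorem RealOneOneForm.form_antisymm (ρ : RealOneOneForm n X) (x : X) (u v : Cn n) :
    ρ.form x u v = -ρ.form x v u := by
  have h := (ρ.val x).toAlternatingMap.map_swap (![u, v] : Fin 2 → Tan n x)
    (show (0 : Fin 2) ≠ 1 by decide)
  have h2 : ((![u, v] : Fin 2 → Tan n x) ∘ Equiv.swap (0 : Fin 2) 1) = ![v, u] := by
    funext i
    fin_cases i <;> rfl
  rw [h2] at h
  exact neg_eq_iff_eq_neg.1 h.symm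

theorem RealOneOneForm.isInvariantForm (ρ : RealOneOneForm n X) (x : X) :
    IsInvariantForm (ρ.form x) := by
  have hadd : ∀ u u' v, ρ.form x (u + u') v = ρ.form x u v + ρ.form x u' v := fun u u' v =>
    (ρ.val x).vecCons_add ![(v : Tan n x)] u u'
  have hsmul : ∀ (r : ℝ) u v, ρ.form x ((r : ℂ) • u) v = r * ρ.form x u v := fun r u v =>
    (ρ.val x).vecCons_smul ![(v : Tan n x)] r u
  refine ⟨hadd, fun u v v' => ?_, hsmul, fun r u v => ?_, fun u v => ρ.type_one_one x _ _⟩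
  · rw [ρ.form_antisymm, hadd, ρ.form_antisymm x v, ρ.form_antisymm x v']; ring
  · rw [ρ.form_antisymm, hsmul, ρ.form_antisymm x v]; ring

/-- The matrix `(g_{i j̄})` in a chart. -/
def HermitianMetric.mat (g : HermitianMetric n X) (e : OpenPartialHomeomorph X (Cn n)) (y : Cn n) :
    Matrix (Fin n) (Fin n) ℂ := of fun a b => g.comp e a b y

/-- The matrix `(ρ_{i j̄})` in a chart. -/
def RealOneOneForm.mat (ρ : RealOneOneForm n X) (e : OpenPartialHomeomorph X (Cn n)) (y : Cn n) :
    Matrix (Fin n) (Fin n) ℂ := of fun a b => ρ.comp e a b y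

variable (g : HermitianMetric n X) (ρ : RealOneOneForm n X)
  (e : OpenPartialHomeomorph X (Cn n)) (y : Cn n)

theorem HermitianMetric.mat_eq_mixedMat :
    g.mat e y = mixedMat fun u v => g.form (e.symm y) (dSymmLin e y u) (dSymmLin e y v) := by
  ext i j
  exact (mixed_map (g.form (e.symm y)) (dSymmLin e y) (stdVec i) (stdVec j)).symm

theorem RealOneOneForm.mat_eq_mixedMat :
    ρ.mat e y = -Complex.I • mixedMat fun u v =>
      ρ.form (e.symm y) (dSymmLin e y u) (dSymmLin e y v) := by
  ext i j
  exact congrArg (-Complex.I * ·)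
    (mixed_map (ρ.form (e.symm y)) (dSymmLin e y) (stdVec i) (stdVec j)).symm

theorem RealOneOneForm.mat_isHermitian : (ρ.mat e y).IsHermitian := by
  refine IsHermitian.ext fun i j => ?_
  rw [ρ.mat_eq_mixedMat]
  exact (((ρ.isInvariantForm (e.symm y)).comp (dSymmLin e y)).mixed_antisymm
    (fun u v => ρ.form_antisymm _ _ _) (stdVec j) (stdVec i)).symm

theorem dSymm_injective (he : e ∈ holCharts n X) {y : Cn n} (hy : y ∈ e.target) :
    Function.Injective (dSymmLin e y) := by
  have h1 : MDifferentiableAt 𝓘(ℂ, Cn n) 𝓘(ℂ, Cn n) e.symm y :=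
    (contMDiffAt_symm_of_mem_maximalAtlas he hy).mdifferentiableAt (by simp)
  have h2 : MDifferentiableAt 𝓘(ℂ, Cn n) 𝓘(ℂ, Cn n) e (e.symm y) :=
    (contMDiffAt_of_mem_maximalAtlas he (e.map_target hy)).mdifferentiableAt (by simp)
  have h3 := mfderiv_comp y h2 h1
  have h4 : e ∘ e.symm =ᶠ[𝓝 y] id := by
    filter_upwards [e.open_target.mem_nhds hy] with z hz using e.right_inv hz
  rw [h4.mfderiv_eq, mfderiv_id] at h3
  intro u v huv
  have h5 := fun w => DFunLike.congr_fun h3 w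
  have h6 : ∀ w : Cn n, w = mfderiv 𝓘(ℂ, Cn n) 𝓘(ℂ, Cn n) e (e.symm y) (dSymmLin e y w) := h5
  rw [h6 u, h6 v, huv]

theorem HermitianMetric.mat_posDef (he : e ∈ holCharts n X) {y : Cn n} (hy : y ∈ e.target) :
    (g.mat e y).PosDef := by
  rw [g.mat_eq_mixedMat]
  refine mixedMat_posDef ((g.isInvariantForm (e.symm y)).comp (dSymmLin e y))
    (fun u v => g.symm _ _ _) fun u hu => g.pos _ _ fun h => hu ?_
  exact dSymm_injective e he hy (h.trans (map_zero (dSymmLin e y)).symm)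

theorem HermitianMetric.det_mat_ne_zero (he : e ∈ holCharts n X) {y : Cn n} (hy : y ∈ e.target) :
    (g.mat e y).det ≠ 0 := (g.mat_posDef e he hy).det_pos.ne'

theorem HermitianMetric.smoothMatOn (he : e ∈ holCharts n X) :
    SmoothMatOn (g.mat e) e.target := fun i j => by
  have h : ∀ u v : Cn n, ContDiffOn ℝ ∞
      (fun y => ((g.form (e.symm y) (dSymmLin e y u) (dSymmLin e y v) : ℝ) : ℂ)) e.target :=
    fun u v => Complex.ofRealCLM.contDiff.comp_contDiffOn (g.smooth e he u v)
  have h2 : (fun z => g.mat e z i j) = fun z => (1 / 2 : ℂ) *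
      ((g.form (e.symm z) (dSymmLin e z (stdVec i)) (dSymmLin e z (stdVec j)) : ℝ) +
      Complex.I * (g.form (e.symm z) (dSymmLin e z (stdVec i))
        (dSymmLin e z (Complex.I • stdVec j)) : ℝ)) := by
    funext z
    rw [g.mat_eq_mixedMat]
    exact ((g.isInvariantForm (e.symm z)).comp (dSymmLin e z)).mixed_eq _ _
  rw [h2]
  exact contDiffOn_const.mul ((h _ _).add (contDiffOn_const.mul (h _ _)))

theorem RealOneOneForm.chartForm_apply (u v : Cn n) :
    chartForm ρ.val e y ![u, v] = ρ.form (e.symm y) (dSymmLin e y u) (dSymmLin e y v) := by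
  rw [chartForm, ContinuousAlternatingMap.compContinuousLinearMap_apply, RealOneOneForm.form]
  congr 1
  funext i
  fin_cases i <;> rfl

theorem RealOneOneForm.contDiffOn_form (he : e ∈ holCharts n X) (u v : Cn n) : ContDiffOn ℝ ∞
    (fun y => ρ.form (e.symm y) (dSymmLin e y u) (dSymmLin e y v)) e.target := by
  have := (ContinuousAlternatingMap.apply ℝ (Cn n) ℝ ![u, v]).contDiff.comp_contDiffOn
    (ρ.smooth e he)
  refine this.congr fun z hz => ?_
  exact (ρ.chartForm_apply e z u v).symm

theorem RealOneOneForm.mat_apply (i j : Fin n) : ρ.mat e y i j = (-Complex.I / 2) *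
    ((ρ.form (e.symm y) (dSymmLin e y (stdVec i)) (dSymmLin e y (stdVec j)) : ℝ) +
      Complex.I * (ρ.form (e.symm y) (dSymmLin e y (stdVec i))
        (dSymmLin e y (Complex.I • stdVec j)) : ℝ)) := by
  rw [ρ.mat_eq_mixedMat]
  refine (congrArg (-Complex.I * ·)
    (((ρ.isInvariantForm (e.symm y)).comp (dSymmLin e y)).mixed_eq (stdVec i) (stdVec j))).trans ?_
  ring

theorem RealOneOneForm.smoothMatOn (he : e ∈ holCharts n X) :
    SmoothMatOn (ρ.mat e) e.target := fun i j => by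
  have h : ∀ u v : Cn n, ContDiffOn ℝ ∞
      (fun y => ((ρ.form (e.symm y) (dSymmLin e y u) (dSymmLin e y v) : ℝ) : ℂ)) e.target :=
    fun u v => Complex.ofRealCLM.contDiff.comp_contDiffOn (ρ.contDiffOn_form e he u v)
  simp only [ρ.mat_apply]
  exact contDiffOn_const.mul ((h _ _).add (contDiffOn_const.mul (h _ _)))

/-- Closedness in components: `∂ₖ ρ_{i j̄} = ∂ᵢ ρ_{k j̄}`. -/
theorem RealOneOneForm.Closed.wirtMat_symm {ρ : RealOneOneForm n X} (hρ : ρ.Closed)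
    {e : OpenPartialHomeomorph X (Cn n)} (he : e ∈ holCharts n X) {y : Cn n} (hy : y ∈ e.target)
    (k i j : Fin n) :
    wirtMat (-Complex.I) k (ρ.mat e) y i j = wirtMat (-Complex.I) i (ρ.mat e) y k j := by
  set θ : Cn n → Cn n → Cn n → ℝ := fun v w y =>
    ρ.form (e.symm y) (dSymmLin e y v) (dSymmLin e y w) with hθ
  have hd : ∀ v w, DifferentiableAt ℝ (θ v w) y := fun v w =>
    ((ρ.contDiffOn_form e he v w).contDiffAt (e.open_target.mem_nhds hy)).differentiableAt (by simp)
  set D : Cn n → Cn n → Cn n → ℝ := fun u v w => fderiv ℝ (θ v w) y u with hD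
  have hanti : ∀ u v w, D u v w = -D u w v := fun u v w => by
    have : θ v w = fun y => -θ w v y := by funext z; exact ρ.form_antisymm _ _ _
    simp only [hD]
    rw [this, fderiv_fun_neg]
    rfl
  have hJ : ∀ u v w, D u (Complex.I • v) w = -D u v (Complex.I • w) := fun u v w => by
    have : θ (Complex.I • v) w = fun y => -θ v (Complex.I • w) y := by
      funext z
      exact ((ρ.isInvariantForm (e.symm z)).comp (dSymmLin e z)).I_smul_left v w
    simp only [hD]
    rw [this, fderiv_fun_neg]
    rfl
  -- The equation `dρ = 0` on three constant real vectors, with `D u v w` the derivative of `ρ(v,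
  -- w)` along `u`.
  have hcl : ∀ u v w, D u v w - D v u w + D w u v = 0 := fun u v w => by
    have h1 := extDeriv_apply (((ρ.smooth e he).contDiffAt
      (e.open_target.mem_nhds hy)).differentiableAt (by simp)) ![u, v, w]
    rw [hρ e he y hy] at h1
    have h2 : ∀ a b : Cn n, (fun y => chartForm ρ.val e y ![a, b]) = θ a b := fun a b => by
      funext z; exact ρ.chartForm_apply e z a b
    have e0 : (0 : Fin 3).removeNth ![u, v, w] = ![v, w] := by
      funext i; fin_cases i <;> rfl
    have e1 : (1 : Fin 3).removeNth ![u, v, w] = ![u, w] := by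
      funext i; fin_cases i <;> rfl
    have e2 : (2 : Fin 3).removeNth ![u, v, w] = ![u, v] := by
      funext i; fin_cases i <;> rfl
    rw [Fin.sum_univ_three, e0, e1, e2, h2, h2, h2] at h1
    simp only [hD]
    simp at h1
    linarith
  have hw : ∀ k i, wirtMat (-Complex.I) k (ρ.mat e) y i j = (-Complex.I / 4) *
      ((D (stdVec k) (stdVec i) (stdVec j) + D (Complex.I • stdVec k) (stdVec i)
          (Complex.I • stdVec j) : ℝ) + Complex.I * (D (stdVec k) (stdVec i) (Complex.I • stdVec j)
        - D (Complex.I • stdVec k) (stdVec i) (stdVec j) : ℝ)) := by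
    intro k i
    have hc : ∀ v w u, fderiv ℝ (fun z => ((θ v w z : ℝ) : ℂ)) y u = (D u v w : ℂ) :=
        fun v w u => by
      have h : fderiv ℝ (fun z => ((θ v w z : ℝ) : ℂ)) y = Complex.ofRealCLM.comp
          (fderiv ℝ (θ v w) y) :=
        (Complex.ofRealCLM.hasFDerivAt.comp y (hd v w).hasFDerivAt).fderiv
      rw [h]
      rfl
    have hdc : ∀ v w, DifferentiableAt ℝ (fun z => ((θ v w z : ℝ) : ℂ)) y := fun v w =>
      Complex.ofRealCLM.differentiableAt.comp y (hd v w)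
    have hf : (fun z => ρ.mat e z i j) = fun z => (-Complex.I / 2) *
        (((θ (stdVec i) (stdVec j) z : ℝ) : ℂ) +
        Complex.I * ((θ (stdVec i) (Complex.I • stdVec j) z : ℝ) : ℂ)) := by
      funext z; exact ρ.mat_apply e z i j
    rw [wirtMat_apply, hf, wirt_const_mul _ ((hdc _ _).fun_add ((hdc _ _).const_mul _)),
      wirt_add (hdc _ _) ((hdc _ _).const_mul _), wirt_const_mul _ (hdc _ _)]
    simp only [wirt, hc]
    push_cast
    linear_combination (-(Complex.I / 4) *
      (-D (Complex.I • stdVec k) (stdVec i) (Complex.I • stdVec j))) * Complex.I_mul_I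
  have hinv : ∀ u v w, D u (Complex.I • v) (Complex.I • w) = D u v w := fun u v w => by
    have : θ (Complex.I • v) (Complex.I • w) = θ v w := by
      funext z
      exact ((ρ.isInvariantForm (e.symm z)).comp (dSymmLin e z)).invariant v w
    simp only [hD, this]
  rw [hw, hw]
  set K : Cn n := stdVec k
  set I : Cn n := stdVec i
  set J : Cn n := stdVec j
  -- The two goals are the real combinations making up the equation `dρ(∂_k, ∂_i, ∂_{j̄}) = 0`. The
  -- third derivative term, along `∂_{j̄}`, drops out because `ρ` has type `(1,1)`, which is what
  -- `hJ`, `hinv` and `hanti` express.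
  congr 3
  · linarith [hcl K I J, hcl (Complex.I • K) I (Complex.I • J),
      hcl (Complex.I • I) K (Complex.I • J), hinv I K J, hinv K I J,
      hJ (Complex.I • J) K I, hanti (Complex.I • J) K (Complex.I • I)]
  · refine congrArg _ ?_
    linarith [hcl K I (Complex.I • J), hcl (Complex.I • K) I J, hcl (Complex.I • I) K J,
      hJ I K J, hJ K I J, hJ J K I, hanti J K (Complex.I • I)]

end Chart

end HermitianGeometry

end

/-! ### Chern torsion, `Q` and `|ρ|²` in components, and the sign of the Laplacian. -/

noncomputable section

namespace HermitianGeometry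

open Topology Matrix
open scoped ComplexOrder

section Components

variable {n : ℕ} {X : Type*} [TopologicalSpace X] [ChartedSpace (Cn n) X]
  (g : HermitianMetric n X) (ρ : RealOneOneForm n X)
  (e : OpenPartialHomeomorph X (Cn n)) (y : Cn n)

namespace HermitianMetric

theorem inv_eq (i j : Fin n) : g.inv e i j y = (g.mat e y)⁻¹ j i := rfl

theorem Gam_eq (k i j : Fin n) :
    g.Gam e k i j y = (wirtMat (-Complex.I) k (g.mat e) y * (g.mat e y)⁻¹) i j := by
  rw [Gam, mul_apply]
  refine Finset.sum_congr rfl fun m _ => ?_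
  rw [dz_eq_wirt, inv_eq, mul_comm]
  rfl

/-- Lowering the index cancels the inverse metric in `Γ = ∂G G⁻¹`, so the torsion is the
antisymmetrized first derivative of the metric. -/
theorem torsionLow_eq (he : e ∈ holCharts n X) {y : Cn n} (hy : y ∈ e.target) (i j k : Fin n) :
    g.torsionLow e i j k y =
      wirtMat (-Complex.I) i (g.mat e) y j k - wirtMat (-Complex.I) j (g.mat e) y i k := by
  have h : ∀ A : Matrix (Fin n) (Fin n) ℂ, ∀ j, ∑ l, (A * (g.mat e y)⁻¹) j l * g.comp e l k y =
      A j k := fun A j => by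
    calc _ = (A * (g.mat e y)⁻¹ * g.mat e y) j k := (mul_apply ..).symm
      _ = A j k := by
        rw [Matrix.mul_assoc, nonsing_inv_mul _ (isUnit_iff_ne_zero.2 (g.det_mat_ne_zero e he hy)),
          Matrix.mul_one]
  simp only [torsionLow, torsion, Gam_eq, sub_mul, Finset.sum_sub_distrib, h]

/-- `|ρ|² = tr (P G⁻¹)²` in a chart. -/
def traceSq (y : Cn n) : ℂ :=
  (ρ.mat e y * (g.mat e y)⁻¹ * (ρ.mat e y * (g.mat e y)⁻¹)).trace

theorem contDiffOn_traceSq (he : e ∈ holCharts n X) :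
    ContDiffOn ℝ ∞ (g.traceSq ρ e) e.target :=
  (((ρ.smoothMatOn e he).mul ((g.smoothMatOn e he).inv fun _ hz => g.det_mat_ne_zero e he hz)).mul
    ((ρ.smoothMatOn e he).mul
      ((g.smoothMatOn e he).inv fun _ hz => g.det_mat_ne_zero e he hz))).trace

/-- The function `|ρ|²` on the manifold. -/
def normSq (x : X) : ℝ :=
  ((-Complex.I • mixedMat (ρ.form x)) * (mixedMat (g.form x))⁻¹ *
    ((-Complex.I • mixedMat (ρ.form x)) * (mixedMat (g.form x))⁻¹)).trace.re

/-- The tangent space at a point is itself `ℂⁿ`, so `normSq` needs no choice of chart. The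
differential of a chart's inverse acts on both forms by one congruence, under which the trace is
invariant. -/
theorem normSq_symm (he : e ∈ holCharts n X) {y : Cn n} (hy : y ∈ e.target) :
    g.normSq ρ (e.symm y) = (g.traceSq ρ e y).re := by
  rw [traceSq, g.mat_eq_mixedMat, ρ.mat_eq_mixedMat, mixedMat_comp (g.isInvariantForm _),
    mixedMat_comp (ρ.isInvariantForm _), ← Matrix.smul_mul, ← Matrix.mul_smul,
    trace_sq_congruence (det_linMat_ne_zero (dSymm_injective e he hy)), normSq]

variable {g ρ e} in
theorem HasConstantTrace.trace_eq (h : g.HasConstantTrace ρ) :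
    ∃ c : ℂ, ∀ e ∈ holCharts n X, ∀ y ∈ e.target, (ρ.mat e y * (g.mat e y)⁻¹).trace = c := by
  obtain ⟨c, hc⟩ := h
  refine ⟨c, fun e he y hy => (Eq.trans ?_ (hc e he y hy))⟩
  simp only [trace, diag_apply, mul_apply]
  refine Finset.sum_congr rfl fun i _ => Finset.sum_congr rfl fun j _ => ?_
  rw [inv_eq, mul_comm]
  rfl

theorem QEval_single (m k : Fin n) :
    g.QEval e y (Pi.single m 1) (Pi.single m 1) (Pi.single k 1) (Pi.single k 1) =
      g.Q e m m k k y := by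
  simp [QEval, Pi.single_apply]

/-- At `G = 1`, `-∂_{m̄}(∂_m G G⁻¹) = -∂_{m̄} ∂_m G + ∂_m G (∂_m G)ᴴ`, whose diagonal entries
produce the positive sum of squares. The last sum consists of `|T_{k p m̄}|²`. This is exactly the
bracket in the Bochner formula. -/
theorem Q_re_of_mat_eq_one (he : e ∈ holCharts n X) {y : Cn n} (hy : y ∈ e.target)
    (hG : g.mat e y = 1) (m k : Fin n) :
    (g.Q e m m k k y).re =
      -(wirtMat Complex.I m (wirtMat (-Complex.I) m (g.mat e)) y k k).re
        + ∑ p, Complex.normSq (wirtMat (-Complex.I) m (g.mat e) y k p)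
        - ∑ p, Complex.normSq (wirtMat (-Complex.I) k (g.mat e) y p m
          - wirtMat (-Complex.I) p (g.mat e) y k m) := by
  have hU := e.open_target
  have hs := g.smoothMatOn e he
  have hdet : ∀ z ∈ e.target, (g.mat e z).det ≠ 0 := fun z hz => g.det_mat_ne_zero e he hz
  have hone : ∀ l, g.comp e l k y = if l = k then 1 else 0 := fun l => by
    rw [← one_apply, ← hG]; rfl
  have h1 : g.curvLow e m m k k y = -(wirtMat Complex.I m (wirtMat (-Complex.I) m (g.mat e)) y k k)
      + ∑ p, wirtMat (-Complex.I) m (g.mat e) y k p *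
        star (wirtMat (-Complex.I) m (g.mat e) y k p) := by
    have h2 : g.curvLow e m m k k y = g.curv e m m k k y := by
      simp [curvLow, hone]
    have h3 : g.Gam e m k k =
        fun z => (wirtMat (-Complex.I) m (g.mat e) z * (g.mat e z)⁻¹) k k := by
      funext z
      exact g.Gam_eq e z m k k
    rw [h2, curv, dzbar_eq_wirt, h3, ← wirtMat_apply
      (F := fun z => wirtMat (-Complex.I) m (g.mat e) z * (g.mat e z)⁻¹),
      wirtMat_mul hU (hs.wirtMat hU) (hs.inv hdet) hy, wirtMat_inv hU hs hdet hy, hG,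
      wirtMat_eq_conjTranspose hU hs (fun z hz => (g.mat_posDef e he hz).1) hy]
    simp only [inv_one, mul_one, one_mul, mul_neg, Matrix.add_apply, Matrix.neg_apply, mul_apply,
      conjTranspose_apply]
    ring
  have h2 : ∀ p q, g.inv e p q y = if p = q then 1 else 0 := fun p q => by
    rw [inv_eq, hG, inv_one, one_apply]
    simp only [eq_comm]
  have hn : ∀ z : ℂ, z * star z = (Complex.normSq z : ℂ) := fun z => Complex.mul_conj z
  rw [Q, h1]
  simp only [h2, ite_mul, one_mul, zero_mul, Finset.sum_ite_eq, Finset.mem_univ, if_true, hn,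
    g.torsionLow_eq e he hy]
  simp only [← Complex.ofReal_sum, Complex.sub_re, Complex.add_re, Complex.neg_re,
    Complex.ofReal_re]

theorem QNonneg.sum_nonneg {g : HermitianMetric n X} (hQ : g.QNonneg)
    {e : OpenPartialHomeomorph X (Cn n)} (he : e ∈ holCharts n X) {y : Cn n} (hy : y ∈ e.target)
    (hG : g.mat e y = 1) (lam : Fin n → ℝ) :
    0 ≤ ∑ k, ∑ m, (g.Q e m m k k y).re * (lam k ^ 2 - lam k * lam m) := by
  have h := hQ e he y hy (fun a => Pi.single a 1) (fun a b => ?_) lam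
  · simpa only [QEval_single] using h
  · have hone : g.comp e a b y = if a = b then 1 else 0 := by
      rw [← one_apply, ← hG]; rfl
    simp [Pi.single_apply, hone]

end HermitianMetric

variable {g ρ e y}

/-- In a chart which is unitary and diagonalizes `ρ` at a point, the Laplacian of `|ρ|²` is
nonnegative there. -/
theorem laplacian_traceSq_nonneg (hQ : g.QNonneg) (hclosed : ρ.Closed)
    (htrace : g.HasConstantTrace ρ) (he : e ∈ holCharts n X) (hy : y ∈ e.target)
    (hG : g.mat e y = 1) {lam : Fin n → ℝ} (hP : ρ.mat e y = diagonal fun i => (lam i : ℂ)) :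
    0 ≤ ∑ k, (wirt Complex.I k (wirt (-Complex.I) k (g.traceSq ρ e)) y).re ∧
    (∑ k, (wirt Complex.I k (wirt (-Complex.I) k (g.traceSq ρ e)) y).re = 0 →
      ∀ k i j, gradDefect lam (fun k => wirtMat (-Complex.I) k (g.mat e) y)
          (fun k => wirtMat (-Complex.I) k (ρ.mat e) y) k i j = 0 ∧
        (lam i + lam k - lam j ≠ 0 → wirtMat (-Complex.I) k (g.mat e) y i j
          = wirtMat (-Complex.I) i (g.mat e) y k j)) := by
  obtain ⟨c, hc⟩ := htrace.trace_eq
  have h := bochner_formula e.open_target (g.smoothMatOn e he) (ρ.smoothMatOn e he)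
    (fun z hz => g.det_mat_ne_zero e he hz) (fun z hz => (g.mat_posDef e he hz).1)
    (fun z _ => ρ.mat_isHermitian e z) (fun z hz => hclosed.wirtMat_symm he hz) (hc e he) hy hG hP
    (a := fun k => wirtMat (-Complex.I) k (g.mat e) y) fun _ => rfl
  simp only [← g.Q_re_of_mat_eq_one e he hy hG] at h
  have hq := hQ.sum_nonneg he hy hG lam
  have h1 : ∀ k i j, 0 ≤ Complex.normSq (gradDefect lam
      (fun k => wirtMat (-Complex.I) k (g.mat e) y)
      (fun k => wirtMat (-Complex.I) k (ρ.mat e) y) k i j) := fun k i j => Complex.normSq_nonneg _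
  have h2 : ∀ k i j, 0 ≤ (1 / 4) * (lam i + lam k - lam j) ^ 2 * Complex.normSq
      (wirtMat (-Complex.I) k (g.mat e) y i j - wirtMat (-Complex.I) i (g.mat e) y k j) :=
    fun k i j => mul_nonneg (by positivity) (Complex.normSq_nonneg _)
  have s1 := Finset.sum_nonneg fun k (_ : k ∈ Finset.univ) => Finset.sum_nonneg
    fun i (_ : i ∈ Finset.univ) => Finset.sum_nonneg fun j (_ : j ∈ Finset.univ) => h1 k i j
  have s2 := Finset.sum_nonneg fun k (_ : k ∈ Finset.univ) => Finset.sum_nonneg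
    fun i (_ : i ∈ Finset.univ) => Finset.sum_nonneg fun j (_ : j ∈ Finset.univ) => h2 k i j
  have hz : ∀ {f : Fin n → Fin n → Fin n → ℝ}, (∀ k i j, 0 ≤ f k i j) →
      ∑ k, ∑ i, ∑ j, f k i j = 0 → ∀ k i j, f k i j = 0 := by
    intro f hf h k i j
    have h3 := (Finset.sum_eq_zero_iff_of_nonneg fun k _ => Finset.sum_nonneg fun i _ =>
      Finset.sum_nonneg fun j _ => hf k i j).1 h k (Finset.mem_univ k)
    have h4 := (Finset.sum_eq_zero_iff_of_nonneg fun i _ => Finset.sum_nonneg fun j _ =>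
      hf k i j).1 h3 i (Finset.mem_univ i)
    exact (Finset.sum_eq_zero_iff_of_nonneg fun j _ => hf k i j).1 h4 j (Finset.mem_univ j)
  change ∑ k, (wirt Complex.I k (wirt (-Complex.I) k (g.traceSq ρ e)) y).re = _ at h
  refine ⟨by rw [h]; linarith, fun h0 k i j => ⟨?_, fun hne => ?_⟩⟩
  · exact Complex.normSq_eq_zero.1 (hz h1 (by linarith) k i j)
  · have h5 := hz h2 (by linarith) k i j
    have h6 : (1 / 4 : ℝ) * (lam i + lam k - lam j) ^ 2 ≠ 0 := by positivity
    exact sub_eq_zero.1 (Complex.normSq_eq_zero.1 ((mul_eq_zero.1 h5).resolve_left h6))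

end Components

end HermitianGeometry

end

/-! ### Linear changes of coordinates and the normal chart at a point. -/

noncomputable section

namespace HermitianGeometry

open Topology Matrix
open scoped ComplexOrder

section Families

variable {n : ℕ}

/-- The trilinear form `∑ X_{i k j} uⁱ vᵏ w̄ʲ` of a family of matrices. -/
def famEval (X : Fin n → Matrix (Fin n) (Fin n) ℂ) (u v w : Fin n → ℂ) : ℂ :=
  ∑ i, u i * (v ⬝ᵥ X i *ᵥ star w)

/-- The family of matrices in the new coordinates under a linear coordinate change. -/
def famCongr (M : Matrix (Fin n) (Fin n) ℂ) (X : Fin n → Matrix (Fin n) (Fin n) ℂ) (i : Fin n) :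
    Matrix (Fin n) (Fin n) ℂ := ∑ p, M p i • (Mᵀ * X p * M.map star)

theorem famEval_eq_sum (X : Fin n → Matrix (Fin n) (Fin n) ℂ) (u v w : Fin n → ℂ) :
    famEval X u v w = ∑ i, ∑ k, ∑ j, X i k j * u i * v k * star (w j) := by
  simp only [famEval, dotProduct, mulVec, Finset.mul_sum, Pi.star_apply]
  refine Finset.sum_congr rfl fun i _ => Finset.sum_congr rfl fun k _ =>
    Finset.sum_congr rfl fun j _ => ?_
  ring

theorem famEval_famCongr (M : Matrix (Fin n) (Fin n) ℂ) (X : Fin n → Matrix (Fin n) (Fin n) ℂ)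
    (u v w : Fin n → ℂ) :
    famEval (famCongr M X) u v w = famEval X (M *ᵥ u) (M *ᵥ v) (M *ᵥ w) := by
  have h1 : ∀ p, v ⬝ᵥ (Mᵀ * X p * M.map star) *ᵥ star w = (M *ᵥ v) ⬝ᵥ X p *ᵥ star (M *ᵥ w) := by
    intro p
    have h2 : star (M *ᵥ w) = M.map star *ᵥ star w := by
      ext a
      simp [mulVec, dotProduct]
    rw [h2, ← mulVec_mulVec, ← mulVec_mulVec, dotProduct_mulVec v Mᵀ, vecMul_transpose]
  simp only [famEval, famCongr, sum_mulVec, dotProduct_sum, smul_mulVec, dotProduct_smul, h1,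
    smul_eq_mul, Finset.mul_sum]
  rw [Finset.sum_comm]
  refine Finset.sum_congr rfl fun p _ => ?_
  rw [show (M *ᵥ u) p = ∑ i, M p i * u i from rfl, Finset.sum_mul]
  refine Finset.sum_congr rfl fun i _ => ?_
  ring

theorem famEval_single (X : Fin n → Matrix (Fin n) (Fin n) ℂ) (i k j : Fin n) :
    famEval X (Pi.single i 1) (Pi.single k 1) (Pi.single j 1) = X i k j := by
  simp [famEval_eq_sum, Pi.single_apply]

theorem famEval_swap {X Y : Fin n → Matrix (Fin n) (Fin n) ℂ} (h : ∀ i k j, X i k j = Y k i j)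
    (u v w : Fin n → ℂ) : famEval X u v w = famEval Y v u w := by
  rw [famEval_eq_sum, famEval_eq_sum, Finset.sum_comm]
  refine Finset.sum_congr rfl fun k _ => Finset.sum_congr rfl fun i _ =>
    Finset.sum_congr rfl fun j _ => ?_
  rw [h]
  ring

/-- Both unbarred slots of the trilinear form transform by the same invertible `M`, so an identity
that exchanges them may be checked in the normal chart. -/
theorem eq_swap_of_famCongr {M : Matrix (Fin n) (Fin n) ℂ} (hM : M.det ≠ 0)
    {X Y : Fin n → Matrix (Fin n) (Fin n) ℂ}
    (h : ∀ i k j, famCongr M X i k j = famCongr M Y k i j) (i k j : Fin n) :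
    X i k j = Y k i j := by
  have h1 : ∀ v, M *ᵥ (M⁻¹ *ᵥ v) = v := fun v => by
    rw [mulVec_mulVec, mul_nonsing_inv _ (isUnit_iff_ne_zero.2 hM), one_mulVec]
  have h2 := famEval_swap h (M⁻¹ *ᵥ Pi.single i 1) (M⁻¹ *ᵥ Pi.single k 1) (M⁻¹ *ᵥ Pi.single j 1)
  rwa [famEval_famCongr, famEval_famCongr, h1, h1, h1, famEval_single, famEval_single] at h2

/-- The part of `∇⁺ρ` in which the first index is the direction of differentiation. -/
def bismutFst (P G : Matrix (Fin n) (Fin n) ℂ) (r a : Fin n → Matrix (Fin n) (Fin n) ℂ)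
    (i : Fin n) : Matrix (Fin n) (Fin n) ℂ := r i - P * G⁻¹ * a i

/-- The part of `∇⁺ρ` in which the second index is the direction of differentiation. -/
def bismutSnd (P G : Matrix (Fin n) (Fin n) ℂ) (a : Fin n → Matrix (Fin n) (Fin n) ℂ)
    (k : Fin n) : Matrix (Fin n) (Fin n) ℂ := a k * (G⁻¹ * P) - ∑ q, (P * G⁻¹) k q • a q

/-- This and `bismutSnd_congr` say that the two parts of `∇⁺ρ` are tensorial under linear changes,
so that their equality, up to exchange of indices, can be transported from the normal chart. -/
theorem bismutFst_congr {M : Matrix (Fin n) (Fin n) ℂ} (hM : M.det ≠ 0)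
    (P G : Matrix (Fin n) (Fin n) ℂ) (r a : Fin n → Matrix (Fin n) (Fin n) ℂ) :
    bismutFst (Mᵀ * P * M.map star) (Mᵀ * G * M.map star) (famCongr M r) (famCongr M a) =
      famCongr M (bismutFst P G r a) := by
  have h1 : IsUnit Mᵀ.det := by rwa [det_transpose, isUnit_iff_ne_zero]
  funext i
  rw [bismutFst, mul_inv_congruence hM]
  simp only [famCongr, bismutFst, Matrix.mul_sum, ← Finset.sum_sub_distrib, Matrix.mul_smul,
    ← smul_sub]
  refine Finset.sum_congr rfl fun p _ => ?_
  congr 1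
  rw [Matrix.mul_sub, Matrix.sub_mul]
  congr 1
  calc Mᵀ * (P * G⁻¹) * Mᵀ⁻¹ * (Mᵀ * a p * M.map star)
      = Mᵀ * (P * G⁻¹) * (Mᵀ⁻¹ * Mᵀ) * a p * M.map star := by simp only [Matrix.mul_assoc]
    _ = _ := by rw [nonsing_inv_mul _ h1, Matrix.mul_one]; simp only [Matrix.mul_assoc]

theorem bismutSnd_congr {M : Matrix (Fin n) (Fin n) ℂ} (hM : M.det ≠ 0)
    (P G : Matrix (Fin n) (Fin n) ℂ) (a : Fin n → Matrix (Fin n) (Fin n) ℂ) :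
    bismutSnd (Mᵀ * P * M.map star) (Mᵀ * G * M.map star) (famCongr M a) =
      famCongr M (bismutSnd P G a) := by
  have h1 : IsUnit Mᵀ.det := by rwa [det_transpose, isUnit_iff_ne_zero]
  have h2 : IsUnit (M.map star).det := by
    rw [isUnit_iff_ne_zero, ← conjTranspose_transpose, det_transpose, det_conjTranspose]
    simpa using hM
  have h3 : (Mᵀ * G * M.map star)⁻¹ * (Mᵀ * P * M.map star) =
      (M.map star)⁻¹ * (G⁻¹ * P) * M.map star := by
    rw [Matrix.mul_inv_rev, Matrix.mul_inv_rev]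
    calc (M.map star)⁻¹ * (G⁻¹ * Mᵀ⁻¹) * (Mᵀ * P * M.map star)
        = (M.map star)⁻¹ * G⁻¹ * (Mᵀ⁻¹ * Mᵀ) * P * M.map star := by simp only [Matrix.mul_assoc]
      _ = _ := by rw [nonsing_inv_mul _ h1, Matrix.mul_one]; simp only [Matrix.mul_assoc]
  funext k
  rw [bismutSnd, mul_inv_congruence hM, h3]
  have h4 : famCongr M a k * ((M.map star)⁻¹ * (G⁻¹ * P) * M.map star) =
      ∑ p, M p k • (Mᵀ * (a p * (G⁻¹ * P)) * M.map star) := by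
    rw [famCongr, Matrix.sum_mul]
    refine Finset.sum_congr rfl fun p _ => ?_
    rw [Matrix.smul_mul]
    congr 1
    calc Mᵀ * a p * M.map star * ((M.map star)⁻¹ * (G⁻¹ * P) * M.map star)
        = Mᵀ * a p * (M.map star * (M.map star)⁻¹) * (G⁻¹ * P) * M.map star := by
          simp only [Matrix.mul_assoc]
      _ = _ := by rw [mul_nonsing_inv _ h2, Matrix.mul_one]; simp only [Matrix.mul_assoc]
  set R := P * G⁻¹
  have h5 : ∑ q, (Mᵀ * R * Mᵀ⁻¹) k q • famCongr M a q =
      ∑ p, M p k • (Mᵀ * (∑ q, R p q • a q) * M.map star) := by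
    have h6 : ∑ q, (Mᵀ * R * Mᵀ⁻¹) k q • famCongr M a q =
        ∑ p, (Mᵀ * R) k p • (Mᵀ * a p * M.map star) := by
      simp only [famCongr, Finset.smul_sum, smul_smul]
      rw [Finset.sum_comm]
      refine Finset.sum_congr rfl fun p _ => ?_
      rw [← Finset.sum_smul]
      congr 1
      calc ∑ q, (Mᵀ * R * Mᵀ⁻¹) k q * M p q = (Mᵀ * R * Mᵀ⁻¹ * Mᵀ) k p := by
            rw [mul_apply]; rfl
        _ = _ := by rw [Matrix.mul_assoc, nonsing_inv_mul _ h1, Matrix.mul_one]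
    rw [h6]
    simp only [Matrix.mul_sum, Matrix.sum_mul, Matrix.mul_smul, Matrix.smul_mul, Finset.smul_sum,
      smul_smul]
    rw [Finset.sum_comm]
    refine Finset.sum_congr rfl fun p _ => ?_
    rw [← Finset.sum_smul]
    rfl
  rw [h4, h5, ← Finset.sum_sub_distrib]
  refine Finset.sum_congr rfl fun p _ => ?_
  rw [← smul_sub, bismutSnd, ← Matrix.sub_mul, ← Matrix.mul_sub]

end Families

section LinearChange

variable {n : ℕ}

/-- The chain rule. As `v ↦ L v - √-1 L (√-1 v)` is complex linear for real linear `L`, no barred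
derivatives appear. -/
theorem wirt_comp_linear (A : Cn n ≃L[ℂ] Cn n) (i : Fin n) {f : Cn n → ℂ} {y : Cn n}
    (hf : DifferentiableAt ℝ f (A y)) :
    wirt (-Complex.I) i (fun z => f (A z)) y =
      ∑ p, linMat A.toLinearMap p i * wirt (-Complex.I) p f (A y) := by
  have hA : HasFDerivAt (fun z => A z) ((A : Cn n →L[ℂ] Cn n).restrictScalars ℝ) y :=
    ((A : Cn n →L[ℂ] Cn n).restrictScalars ℝ).hasFDerivAt
  have h1 : fderiv ℝ (fun z => f (A z)) y =
      (fderiv ℝ f (A y)).comp ((A : Cn n →L[ℂ] Cn n).restrictScalars ℝ) :=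
    (hf.hasFDerivAt.comp y hA).fderiv
  set L := fderiv ℝ f (A y)
  have h2 : ∀ v, fderiv ℝ (fun z => f (A z)) y v = L (A v) := fun v => by rw [h1]; rfl
  have h3 : ∀ c : ℂ, ∀ v, L (c • v) + -Complex.I * L (Complex.I • c • v) =
      c * (L v + -Complex.I * L (Complex.I • v)) := by
    intro c v
    have h4 : ∀ r : ℝ, ∀ w, L ((r : ℂ) • w) = r * L w := fun r w => by
      rw [Complex.coe_smul, map_smul, Complex.real_smul]
    have h5 : c • v = (c.re : ℂ) • v + (c.im : ℂ) • (Complex.I • v) := by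
      rw [smul_smul, ← add_smul, Complex.re_add_im]
    have h6 : Complex.I • c • v = (c.re : ℂ) • (Complex.I • v) + ((-c.im : ℝ) : ℂ) • v := by
      rw [smul_smul, smul_smul, ← add_smul]
      congr 1
      conv_lhs => rw [← Complex.re_add_im c]
      push_cast
      linear_combination (c.im : ℂ) * Complex.I_mul_I
    rw [h6, h5, map_add, map_add, h4, h4, h4, h4]
    conv_rhs => rw [← Complex.re_add_im c]
    push_cast
    linear_combination (c.im : ℂ) * L (Complex.I • v) * Complex.I_mul_I
  have h7 : A (stdVec i) = ∑ p, linMat A.toLinearMap p i • stdVec p := eq_sum_stdVec _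
  simp only [wirt, h2, map_smul]
  rw [h7, Finset.smul_sum, map_sum, map_sum, Finset.mul_sum, ← Finset.sum_add_distrib,
    Finset.mul_sum]
  refine Finset.sum_congr rfl fun p _ => ?_
  rw [h3]
  ring

/-- The Jacobian is constant, so no derivative falls on it and first derivatives of the components
transform like a tensor with one more index. A nonlinear change would add terms. -/
theorem wirtMat_congruence (A : Cn n ≃L[ℂ] Cn n) {U : Set (Cn n)} (hU : IsOpen U)
    {F F' : Cn n → Matrix (Fin n) (Fin n) ℂ} (hF : SmoothMatOn F U) {y : Cn n} (hy : A y ∈ U)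
    (h : ∀ z, A z ∈ U → F' z =
      (linMat A.toLinearMap)ᵀ * F (A z) * (linMat A.toLinearMap).map star) :
    (fun i => wirtMat (-Complex.I) i F' y) =
      famCongr (linMat A.toLinearMap) fun p => wirtMat (-Complex.I) p F (A y) := by
  set M := linMat A.toLinearMap
  funext i
  have hV : IsOpen (A ⁻¹' U) := hU.preimage A.continuous
  have hFA : SmoothMatOn (fun z => F (A z)) (A ⁻¹' U) := fun a b =>
    (hF a b).comp ((A : Cn n →L[ℂ] Cn n).restrictScalars ℝ).contDiff.contDiffOn fun z hz => hz
  have hc : ∀ N : Matrix (Fin n) (Fin n) ℂ, SmoothMatOn (fun _ : Cn n => N) (A ⁻¹' U) :=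
    fun N a b => contDiffOn_const
  have hc0 : ∀ N : Matrix (Fin n) (Fin n) ℂ,
      wirtMat (-Complex.I) i (fun _ : Cn n => N) y = 0 := fun N => by
    ext a b; exact wirt_const _
  have h1 : wirtMat (-Complex.I) i (fun z => F (A z)) y =
      ∑ p, M p i • wirtMat (-Complex.I) p F (A y) := by
    ext a b
    rw [wirtMat_apply, wirt_comp_linear A i (f := fun z => F z a b)
      (differentiableAt_of_smoothOn hU (hF a b) hy)]
    simp only [Matrix.sum_apply, Matrix.smul_apply, smul_eq_mul]
    rfl
  rw [wirtMat_congr (G := fun z => Mᵀ * F (A z) * M.map star)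
    (by filter_upwards [hV.mem_nhds hy] with z hz using h z hz),
    wirtMat_mul hV ((hc _).mul hFA) (hc _) hy, wirtMat_mul hV (hc _) hFA hy, hc0, hc0, h1]
  simp only [famCongr, Matrix.zero_mul, Matrix.mul_zero, zero_add, add_zero, Matrix.mul_sum,
    Matrix.sum_mul, Matrix.mul_smul, Matrix.smul_mul]

theorem fderiv_fderiv_comp_linear (A : Cn n ≃L[ℂ] Cn n) {U : Set (Cn n)} (hU : IsOpen U)
    {F F' : Cn n → ℝ} (hF : ContDiffOn ℝ 2 F U) {y : Cn n} (hy : A y ∈ U)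
    (h : ∀ z, A z ∈ U → F' z = F (A z)) (v : Cn n) :
    fderiv ℝ (fun z => fderiv ℝ F' z v) y v =
      fderiv ℝ (fun z => fderiv ℝ F z (A v)) (A y) (A v) := by
  have hV : IsOpen (A ⁻¹' U) := hU.preimage A.continuous
  have hA : ∀ z, HasFDerivAt (fun z => A z) ((A : Cn n →L[ℂ] Cn n).restrictScalars ℝ) z :=
    fun z => ((A : Cn n →L[ℂ] Cn n).restrictScalars ℝ).hasFDerivAt
  have h1 : ∀ z ∈ A ⁻¹' U, fderiv ℝ F' z v = fderiv ℝ F (A z) (A v) := fun z hz => by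
    have h2 : F' =ᶠ[𝓝 z] fun z => F (A z) := by
      filter_upwards [hV.mem_nhds hz] with w hw using h w hw
    have h3 : DifferentiableAt ℝ F (A z) :=
      (hF.contDiffAt (hU.mem_nhds hz)).differentiableAt (by norm_num)
    rw [h2.fderiv_eq]
    exact (DFunLike.congr_fun (h3.hasFDerivAt.comp z (hA z)).fderiv v).trans rfl
  have h4 : (fun z => fderiv ℝ F' z v) =ᶠ[𝓝 y] fun z => fderiv ℝ F (A z) (A v) := by
    filter_upwards [hV.mem_nhds hy] with w hw using h1 w hw
  have h5 : DifferentiableAt ℝ (fun z => fderiv ℝ F z (A v)) (A y) :=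
    (((hF.fderiv_of_isOpen hU (m := 1) (by norm_num)).clm_apply contDiffOn_const).contDiffAt
      (hU.mem_nhds hy)).differentiableAt (by norm_num)
  have h6 := (h5.hasFDerivAt.comp y (hA y)).fderiv
  rw [h4.fderiv_eq]
  exact (DFunLike.congr_fun h6 v).trans rfl

variable {X : Type*} [TopologicalSpace X] [ChartedSpace (Cn n) X]

/-- A chart composed with a linear change of coordinates. -/
def linChart (e : OpenPartialHomeomorph X (Cn n)) (A : Cn n ≃L[ℂ] Cn n) :
    OpenPartialHomeomorph X (Cn n) := e.transHomeomorph A.symm.toHomeomorph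

variable {e : OpenPartialHomeomorph X (Cn n)} {A : Cn n ≃L[ℂ] Cn n}

theorem linChart_mem [IsManifold 𝓘(ℂ, Cn n) ω X] (he : e ∈ holCharts n X) :
    linChart e A ∈ holCharts n X := by
  rw [IsManifold.mem_maximalAtlas_iff_contMDiffOn]
  refine ⟨?_, ?_⟩
  · exact A.symm.contDiff.contMDiff.comp_contMDiffOn (contMDiffOn_of_mem_maximalAtlas he)
  · exact (contMDiffOn_symm_of_mem_maximalAtlas he).comp A.contDiff.contMDiff.contMDiffOn
      fun z hz => hz

theorem dSymmLin_linChart (he : e ∈ holCharts n X) {y : Cn n} (hy : A y ∈ e.target) :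
    dSymmLin (linChart e A) y = dSymmLin e (A y) ∘ₗ A.toLinearMap := by
  have h1 : MDifferentiableAt 𝓘(ℂ, Cn n) 𝓘(ℂ, Cn n) e.symm (A y) :=
    (contMDiffAt_symm_of_mem_maximalAtlas he hy).mdifferentiableAt (by simp)
  have h2 : MDifferentiableAt 𝓘(ℂ, Cn n) 𝓘(ℂ, Cn n) A y := A.differentiableAt.mdifferentiableAt
  have h3 := mfderiv_comp y h1 h2
  have h4 : mfderiv 𝓘(ℂ, Cn n) 𝓘(ℂ, Cn n) A y = (A : Cn n →L[ℂ] Cn n) := by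
    rw [mfderiv_eq_fderiv]; exact A.fderiv
  rw [h4] at h3
  ext v : 1
  exact DFunLike.congr_fun h3 v

theorem HermitianMetric.mat_linChart (g : HermitianMetric n X) (he : e ∈ holCharts n X) {y : Cn n}
    (hy : A y ∈ e.target) : g.mat (linChart e A) y =
      (linMat A.toLinearMap)ᵀ * g.mat e (A y) * (linMat A.toLinearMap).map star := by
  rw [g.mat_eq_mixedMat, g.mat_eq_mixedMat, dSymmLin_linChart he hy]
  exact mixedMat_comp ((g.isInvariantForm _).comp _) _

theorem RealOneOneForm.mat_linChart (ρ : RealOneOneForm n X) (he : e ∈ holCharts n X) {y : Cn n}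
    (hy : A y ∈ e.target) : ρ.mat (linChart e A) y =
      (linMat A.toLinearMap)ᵀ * ρ.mat e (A y) * (linMat A.toLinearMap).map star := by
  rw [ρ.mat_eq_mixedMat, ρ.mat_eq_mixedMat, dSymmLin_linChart he hy, Matrix.mul_smul,
    Matrix.smul_mul]
  exact congrArg _ (mixedMat_comp ((ρ.isInvariantForm _).comp _) _)

theorem exists_linMat_eq {M : Matrix (Fin n) (Fin n) ℂ} (hM : M.det ≠ 0) :
    ∃ A : Cn n ≃L[ℂ] Cn n, linMat A.toLinearMap = M := by
  have hu : IsUnit M.det := isUnit_iff_ne_zero.2 hM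
  have h : ∀ N N' : Matrix (Fin n) (Fin n) ℂ, N * N' = 1 →
      toEuclideanLin N ∘ₗ toEuclideanLin N' = LinearMap.id := fun N N' h => by
    ext v : 1
    simp [toLpLin_apply, h]
  refine ⟨(LinearEquiv.ofLinearMap (toEuclideanLin M) (toEuclideanLin M⁻¹)
    (h _ _ (mul_nonsing_inv _ hu)) (h _ _ (nonsing_inv_mul _ hu))).toContinuousLinearEquiv, ?_⟩
  ext a i
  change toEuclideanLin M (stdVec i) a = M a i
  simp [stdVec, toLpLin_apply]

/-- Around every point there is a chart, differing from a given one by a linear change, which is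
unitary at the point and diagonalizes `ρ` there. -/
theorem exists_normal_linChart (g : HermitianMetric n X) (ρ : RealOneOneForm n X)
    (he : e ∈ holCharts n X) {y : Cn n} (hy : y ∈ e.target) :
    ∃ (A : Cn n ≃L[ℂ] Cn n) (lam : Fin n → ℝ), g.mat (linChart e A) (A.symm y) = 1 ∧
      ρ.mat (linChart e A) (A.symm y) = diagonal fun i => (lam i : ℂ) := by
  obtain ⟨M, lam, hM, hG, hP⟩ := exists_simultaneous_diagonalization (g.mat_posDef e he hy)
    (ρ.mat_isHermitian e y)
  obtain ⟨A, rfl⟩ := exists_linMat_eq hM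
  have hy' : A (A.symm y) ∈ e.target := by rwa [A.apply_symm_apply]
  refine ⟨A, lam, ?_, ?_⟩
  · rw [g.mat_linChart he hy', A.apply_symm_apply, hG]
  · rw [ρ.mat_linChart he hy', A.apply_symm_apply, hP]

end LinearChange

end HermitianGeometry

end

/-! ### Uniform ellipticity and local constancy of `|ρ|²`. -/

noncomputable section

namespace HermitianGeometry

open Topology Matrix
open scoped ComplexOrder InnerProductSpace

section Ellipticity

variable {n : ℕ} {X : Type*} [TopologicalSpace X] [ChartedSpace (Cn n) X]
  (g : HermitianMetric n X) (ρ : RealOneOneForm n X) {e : OpenPartialHomeomorph X (Cn n)}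
  {A : Cn n ≃L[ℂ] Cn n}

theorem traceSq_linChart (he : e ∈ holCharts n X) {z : Cn n} (hz : A z ∈ e.target) :
    g.traceSq ρ (linChart e A) z = g.traceSq ρ e (A z) := by
  rw [HermitianMetric.traceSq, g.mat_linChart he hz, ρ.mat_linChart he hz,
    trace_sq_congruence (det_linMat_ne_zero A.injective)]
  rfl

/-- The Laplacian of `|ρ|²` in a linearly changed chart, as a sum of second derivatives in the
original chart. -/
theorem four_mul_laplacian_linChart [IsManifold 𝓘(ℂ, Cn n) ω X] (he : e ∈ holCharts n X) {y : Cn n}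
    (hy : y ∈ e.target) {F : Cn n → ℝ} (hF : ContDiffOn ℝ 2 F e.target)
    (hFe : ∀ z ∈ e.target, F z = (g.traceSq ρ e z).re) :
    4 * ∑ k, (wirt Complex.I k (wirt (-Complex.I) k (g.traceSq ρ (linChart e A)))
      (A.symm y)).re =
    ∑ k, (fderiv ℝ (fun z => fderiv ℝ F z (A (stdVec k))) y (A (stdVec k)) +
      fderiv ℝ (fun z => fderiv ℝ F z (A (Complex.I • stdVec k))) y
        (A (Complex.I • stdVec k))) := by
  have hy' : A (A.symm y) ∈ e.target := by rwa [A.apply_symm_apply]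
  rw [Finset.mul_sum]
  refine Finset.sum_congr rfl fun k _ => ?_
  rw [four_mul_wirt_wirt_re (linChart e A).open_target
    (g.contDiffOn_traceSq ρ (linChart e A) (linChart_mem he)) hy']
  have h : ∀ z, A z ∈ e.target → (g.traceSq ρ (linChart e A) z).re = F (A z) := fun z hz => by
    rw [traceSq_linChart g ρ he hz, hFe _ hz]
  rw [fderiv_fderiv_comp_linear A e.open_target hF hy' h,
    fderiv_fderiv_comp_linear A e.open_target hF hy' h, A.apply_symm_apply]

/-- In a chart the metric is locally comparable to the Euclidean metric. -/
theorem exists_metric_bounds (he : e ∈ holCharts n X) {y₀ : Cn n} (hy₀ : y₀ ∈ e.target) :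
    ∃ C : ℝ, 0 ≤ C ∧ ∃ U, IsOpen U ∧ y₀ ∈ U ∧ U ⊆ e.target ∧ ∀ z ∈ U, ∀ v : Cn n,
      g.form (e.symm z) (dSymmLin e z v) (dSymmLin e z v) ≤ C * ‖v‖ ^ 2 ∧
      ‖v‖ ^ 2 ≤ C * g.form (e.symm z) (dSymmLin e z v) (dSymmLin e z v) := by
  set q : Cn n × Cn n → ℝ := fun p =>
    g.form (e.symm p.1) (dSymmLin e p.1 p.2) (dSymmLin e p.1 p.2) with hq
  have hB := fun z => (g.isInvariantForm (e.symm z)).comp (dSymmLin e z)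
  have hqpos : ∀ z ∈ e.target, ∀ v, v ≠ 0 → 0 < q (z, v) := fun z hz v hv =>
    g.pos _ _ fun h => hv (dSymm_injective e he hz (h.trans (map_zero (dSymmLin e z)).symm))
  have hqc : ContinuousOn q (e.target ×ˢ Set.univ) := by
    have h1 : ∀ p, q p = 2 * (∑ i, ∑ j, p.2 i * star (p.2 j) * g.mat e p.1 i j).re := fun p => by
      rw [g.mat_eq_mixedMat, ← mixed_eq_sum (hB p.1),
        (hB p.1).mixed_self (fun u v => g.symm _ _ _), Complex.ofReal_re]
      simp only [hq]
      ring
    simp only [funext h1]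
    refine continuousOn_const.mul (Complex.continuous_re.comp_continuousOn ?_)
    refine continuousOn_finsetSum _ fun i _ => continuousOn_finsetSum _ fun j _ => ?_
    refine ContinuousOn.mul (Continuous.continuousOn (by fun_prop)) ?_
    exact (g.smoothMatOn e he i j).continuousOn.comp continuousOn_fst fun p hp => hp.1
  -- On the compact product of a closed ball and the unit sphere the quadratic form is continuous
  -- and positive, so it and its inverse are bounded; homogeneity extends the bounds to all vectors.
  obtain ⟨R, hR, hRU⟩ := Metric.nhds_basis_closedBall.mem_iff.1 (e.open_target.mem_nhds hy₀)
  set K : Set (Cn n × Cn n) := Metric.closedBall y₀ R ×ˢ Metric.sphere 0 1 with hK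
  have hKc : IsCompact K := (isCompact_closedBall _ _).prod (isCompact_sphere _ _)
  have hKq : ContinuousOn q K := hqc.mono (Set.prod_mono hRU (Set.subset_univ _))
  have hKpos : ∀ p ∈ K, 0 < q p := fun p hp =>
    hqpos p.1 (hRU hp.1) p.2 (ne_zero_of_mem_unit_sphere ⟨p.2, hp.2⟩)
  obtain ⟨C₁, hC₁⟩ := hKc.exists_bound_of_continuousOn hKq
  obtain ⟨C₂, hC₂⟩ := hKc.exists_bound_of_continuousOn
    (hKq.inv₀ fun p hp => (hKpos p hp).ne')
  refine ⟨max 0 (max C₁ C₂), le_max_left _ _, Metric.ball y₀ R, Metric.isOpen_ball,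
    Metric.mem_ball_self hR, Metric.ball_subset_closedBall.trans hRU, fun z hz v => ?_⟩
  change q (z, v) ≤ _ * ‖v‖ ^ 2 ∧ ‖v‖ ^ 2 ≤ _ * q (z, v)
  rcases eq_or_ne v 0 with rfl | hv
  · have : q (z, 0) = 0 := by
      have := (hB z).smul_left 0 0 0
      simpa [hq] using this
    simp [this]
  have hvn : 0 < ‖v‖ := norm_pos_iff.2 hv
  have hmem : (z, ((‖v‖⁻¹ : ℝ) : ℂ) • v) ∈ K := by
    refine ⟨Metric.ball_subset_closedBall hz, ?_⟩
    rw [mem_sphere_zero_iff_norm, norm_smul, Complex.norm_real, norm_inv, norm_norm,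
      inv_mul_cancel₀ hvn.ne']
  have hscale : q (z, v) = ‖v‖ ^ 2 * q (z, ((‖v‖⁻¹ : ℝ) : ℂ) • v) := by
    have h1 : q (z, ((‖v‖⁻¹ : ℝ) : ℂ) • v) = ‖v‖⁻¹ * (‖v‖⁻¹ * q (z, v)) :=
      ((hB z).smul_left _ _ _).trans (congrArg _ ((hB z).smul_right _ _ _))
    rw [h1]
    field_simp
  have b1 := hC₁ _ hmem
  have b2 := hC₂ _ hmem
  rw [Pi.inv_apply] at b2
  have hp := hKpos _ hmem
  set t := q (z, ((‖v‖⁻¹ : ℝ) : ℂ) • v)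
  rw [Real.norm_eq_abs, abs_of_pos hp] at b1
  rw [Real.norm_eq_abs, abs_of_pos (inv_pos.2 hp)] at b2
  have b3 : t ≤ max 0 (max C₁ C₂) := b1.trans ((le_max_left _ _).trans (le_max_right _ _))
  have b4 : 1 ≤ max 0 (max C₁ C₂) * t := by
    have h1 := b2.trans ((le_max_right C₁ C₂).trans (le_max_right 0 _))
    calc (1 : ℝ) = t⁻¹ * t := (inv_mul_cancel₀ hp.ne').symm
      _ ≤ _ := by gcongr
  rw [hscale]
  constructor
  · rw [mul_comm]; gcongr
  · nlinarith [sq_nonneg ‖v‖]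

/-- The factor `2` arises because `g(∂_{z^i}, ∂_{z̄^i})` is half of `g(∂_{x^i}, ∂_{x^i})`. Through
this identity bounds on the metric become bounds on every normal frame. -/
theorem form_linChart_of_mat_eq_one (he : e ∈ holCharts n X) {y : Cn n} (hy : y ∈ e.target)
    (hG : g.mat (linChart e A) (A.symm y) = 1) (η : Cn n) :
    g.form (e.symm y) (dSymmLin e y (A η)) (dSymmLin e y (A η)) = 2 * ‖η‖ ^ 2 := by
  have hy' : A (A.symm y) ∈ e.target := by rwa [A.apply_symm_apply]
  have hB := (g.isInvariantForm (e.symm y)).comp (dSymmLin e y ∘ₗ A.toLinearMap)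
  have h1 := hB.mixed_self (fun u v => g.symm _ _ _) η
  rw [mixed_eq_sum hB] at h1
  rw [g.mat_eq_mixedMat, dSymmLin_linChart he hy', A.apply_symm_apply] at hG
  have h2 : (linChart e A).symm (A.symm y) = e.symm y := by
    change e.symm (A (A.symm y)) = _
    rw [A.apply_symm_apply]
  rw [h2] at hG
  rw [hG] at h1
  have h3 : ∑ i, ∑ j, η i * star (η j) * (1 : Matrix (Fin n) (Fin n) ℂ) i j =
      ((‖η‖ ^ 2 : ℝ) : ℂ) := by
    rw [EuclideanSpace.norm_sq_eq]
    push_cast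
    refine Finset.sum_congr rfl fun i _ => ?_
    simp only [one_apply, mul_ite, mul_one, mul_zero, Finset.sum_ite_eq, Finset.mem_univ, if_true]
    exact Complex.mul_conj' _
  rw [h3] at h1
  have h4 := Complex.ofReal_injective h1
  change ‖η‖ ^ 2 = g.form (e.symm y) (dSymmLin e y (A η)) (dSymmLin e y (A η)) / 2 at h4
  linarith

/-- The real frame consisting of a complex frame and its multiples by `√-1`. -/
def realFrame (A : Cn n ≃L[ℂ] Cn n) : Fin n ⊕ Fin n → Cn n :=
  Sum.elim (fun k => A (stdVec k)) fun k => A (Complex.I • stdVec k)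

theorem realFrame_bounds {C : ℝ} (hC : 0 ≤ C) (h1 : ∀ η, 2 * ‖η‖ ^ 2 ≤ C * ‖A η‖ ^ 2)
    (h2 : ∀ η, ‖A η‖ ^ 2 ≤ C * (2 * ‖η‖ ^ 2)) :
    (∀ ξ, ‖ξ‖ ^ 2 ≤ C * ∑ k, ⟪ξ, realFrame A k⟫_ℝ ^ 2) ∧
      ∑ k, ‖realFrame A k‖ ^ 2 ≤ 4 * n * C := by
  constructor
  · intro ξ
    set η := A.symm ξ with hη
    have hξ : A η = ξ := A.apply_symm_apply ξ
    set c : Fin n ⊕ Fin n → ℝ := Sum.elim (fun k => (η k).re) fun k => (η k).im with hc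
    set S := ∑ k, ⟪ξ, realFrame A k⟫_ℝ ^ 2 with hS
    have h3 : ξ = ∑ k, c k • realFrame A k := by
      rw [Fintype.sum_sum_type, ← Finset.sum_add_distrib]
      conv_lhs => rw [← hξ, eq_sum_stdVec η, map_sum]
      refine Finset.sum_congr rfl fun k _ => ?_
      simp only [hc, realFrame, Sum.elim_inl, Sum.elim_inr]
      rw [← Complex.coe_smul, ← Complex.coe_smul, ← map_smul, ← map_smul, ← map_add, smul_smul,
        ← add_smul, Complex.re_add_im]
    have h4 : ∑ k, c k ^ 2 = ‖η‖ ^ 2 := by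
      rw [Fintype.sum_sum_type, ← Finset.sum_add_distrib, EuclideanSpace.norm_sq_eq]
      refine Finset.sum_congr rfl fun k _ => ?_
      rw [Complex.sq_norm, Complex.normSq_apply]
      simp only [hc, Sum.elim_inl, Sum.elim_inr]
      ring
    have h5 : ‖ξ‖ ^ 2 = ∑ k, c k * ⟪ξ, realFrame A k⟫_ℝ := by
      calc ‖ξ‖ ^ 2 = ⟪ξ, ∑ k, c k • realFrame A k⟫_ℝ := by
            rw [← h3, real_inner_self_eq_norm_sq]
        _ = _ := by simp only [inner_sum, real_inner_smul_right]
    -- Cauchy–Schwarz gives `‖ξ‖⁴ ≤ ‖η‖² S`. With `2 ‖η‖² ≤ C ‖ξ‖²` this yields `2 ‖ξ‖² ≤ C S`,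
    -- twice what is needed.
    have h6 := Finset.sum_mul_sq_le_sq_mul_sq Finset.univ c fun k => ⟪ξ, realFrame A k⟫_ℝ
    rw [← h5, h4] at h6
    have h7 := h1 η
    rw [hξ] at h7
    have hS0 : 0 ≤ S := Finset.sum_nonneg fun k _ => sq_nonneg _
    rcases eq_or_ne ξ 0 with h0 | h0
    · rw [h0, norm_zero]; simpa using mul_nonneg hC hS0
    · have h8 : 0 < ‖ξ‖ ^ 2 := by positivity
      by_contra! h9
      nlinarith [mul_nonneg hC hS0, mul_le_mul_of_nonneg_right h7 hS0]
  · have h3 : ∀ k : Fin n, ‖(stdVec k : Cn n)‖ = 1 := fun k => by simp [stdVec]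
    have h4 : ∀ k, ‖realFrame A k‖ ^ 2 ≤ 2 * C := by
      rintro (k | k)
      · refine (h2 (stdVec k)).trans (le_of_eq ?_)
        rw [h3]; ring
      · refine (h2 (Complex.I • stdVec k)).trans (le_of_eq ?_)
        rw [norm_smul, Complex.norm_I, h3]; ring
    calc ∑ k, ‖realFrame A k‖ ^ 2 ≤ ∑ _k : Fin n ⊕ Fin n, 2 * C :=
          Finset.sum_le_sum fun k _ => h4 k
      _ = 4 * n * C := by simp; ring

variable {g ρ}

/-- Strong maximum principle for `|ρ|²`. -/
theorem normSq_eventuallyEq_of_isLocalMax [IsManifold 𝓘(ℂ, Cn n) ω X] (hQ : g.QNonneg)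
    (hclosed : ρ.Closed) (htrace : g.HasConstantTrace ρ) {x₀ : X}
    (hmax : IsLocalMax (g.normSq ρ) x₀) : g.normSq ρ =ᶠ[𝓝 x₀] fun _ => g.normSq ρ x₀ := by
  set e := chartAt (Cn n) x₀ with he'
  have he : e ∈ holCharts n X := IsManifold.chart_mem_maximalAtlas x₀
  have hx₀ : x₀ ∈ e.source := mem_chart_source _ _
  have hy₀ : e x₀ ∈ e.target := e.map_source hx₀
  set F : Cn n → ℝ := fun z => (g.traceSq ρ e z).re with hF
  have hF2 : ContDiffOn ℝ 2 F e.target :=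
    Complex.reCLM.contDiff.comp_contDiffOn
      ((g.contDiffOn_traceSq ρ e he).of_le ENat.LEInfty.out)
  obtain ⟨C, hC, U, hU, hyU, hUe, hb⟩ := exists_metric_bounds g he hy₀
  have hmaxF : IsLocalMax F (e x₀) := by
    have h1 : Filter.Tendsto e.symm (𝓝 (e x₀)) (𝓝 x₀) := by
      have := (e.continuousAt_symm hy₀).tendsto
      rwa [e.left_inv hx₀] at this
    filter_upwards [h1.eventually hmax, e.open_target.mem_nhds hy₀] with z hz hze
    simp only [hF]
    rw [← g.normSq_symm ρ e he hze, ← g.normSq_symm ρ e he hy₀, e.left_inv hx₀]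
    exact hz
  -- One constant has to serve both as ellipticity bound, `C`, and as bound on the squared lengths
  -- of the frame, `4 n C`; their sum does.
  have hconst := eventuallyEq_of_isLocalMax hU (hF2.mono hUe) (ι := Fin n ⊕ Fin n)
    (C := C + 4 * n * C) (fun z hz => ?_) hyU hmaxF
  · filter_upwards [(e.continuousAt hx₀).eventually hconst,
      e.open_source.mem_nhds hx₀] with x hx hxs
    have h1 := g.normSq_symm ρ e he (e.map_source hxs)
    have h2 := g.normSq_symm ρ e he hy₀
    rw [e.left_inv hxs] at h1
    rw [e.left_inv hx₀] at h2
    rw [h1, h2]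
    exact hx
  · obtain ⟨A, lam, hG, hP⟩ := exists_normal_linChart g ρ he (hUe hz)
    have hform := form_linChart_of_mat_eq_one g he (hUe hz) hG
    obtain ⟨b1, b2⟩ := realFrame_bounds (A := A) hC
      (fun η => by rw [← hform η]; exact (hb z hz (A η)).1)
      (fun η => by rw [← hform η]; exact (hb z hz (A η)).2)
    refine ⟨realFrame A, fun ξ => (b1 ξ).trans ?_, b2.trans ?_, ?_⟩
    · refine mul_le_mul_of_nonneg_right ?_ (Finset.sum_nonneg fun k _ => sq_nonneg _)
      have : 0 ≤ 4 * n * C := by positivity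
      linarith
    · linarith
    · have hy' : A (A.symm z) ∈ e.target := by rw [A.apply_symm_apply]; exact hUe hz
      have h1 := (laplacian_traceSq_nonneg hQ hclosed htrace (linChart_mem he) hy' hG hP).1
      have h2 := four_mul_laplacian_linChart g ρ (A := A) he (hUe hz) hF2 fun _ _ => rfl
      rw [Fintype.sum_sum_type, ← Finset.sum_add_distrib]
      change 0 ≤ ∑ k, (fderiv ℝ (fun z => fderiv ℝ F z (A (stdVec k))) z (A (stdVec k)) +
        fderiv ℝ (fun z => fderiv ℝ F z (A (Complex.I • stdVec k))) z (A (Complex.I • stdVec k)))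
      rw [← h2]
      linarith

/-- On a compact manifold `|ρ|²` is locally constant. -/
theorem normSq_eventuallyEq [CompactSpace X] [IsManifold 𝓘(ℂ, Cn n) ω X] (hQ : g.QNonneg)
    (hclosed : ρ.Closed) (htrace : g.HasConstantTrace ρ) (x : X) :
    g.normSq ρ =ᶠ[𝓝 x] fun _ => g.normSq ρ x := by
  have hcont : Continuous (g.normSq ρ) := by
    refine continuous_iff_continuousAt.2 fun x₀ => ?_
    set e := chartAt (Cn n) x₀
    have he : e ∈ holCharts n X := IsManifold.chart_mem_maximalAtlas x₀
    have hx₀ : x₀ ∈ e.source := mem_chart_source _ _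
    have h1 : ContinuousAt (fun z => (g.traceSq ρ e z).re) (e x₀) :=
      Complex.continuous_re.continuousAt.comp
        (((g.contDiffOn_traceSq ρ e he).continuousOn).continuousAt
          (e.open_target.mem_nhds (e.map_source hx₀)))
    refine (h1.comp (e.continuousAt hx₀)).congr ?_
    filter_upwards [e.open_source.mem_nhds hx₀] with z hz
    have := g.normSq_symm ρ e he (e.map_source hz)
    rw [e.left_inv hz] at this
    exact this.symm
  -- Components are open, so a maximum over the component of `x` is a local maximum on `X`;
  -- connectedness of `X` is not needed.
  have : LocallyConnectedSpace X := ChartedSpace.locallyConnectedSpace (Cn n) X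
  set S := connectedComponent x with hS
  have hSo : IsOpen S := isOpen_connectedComponent
  obtain ⟨m, hm, hmax⟩ := isClosed_connectedComponent.isCompact.exists_isMaxOn
    ⟨x, mem_connectedComponent⟩ hcont.continuousOn
  have hloc : ∀ z ∈ S, g.normSq ρ z = g.normSq ρ m →
      g.normSq ρ =ᶠ[𝓝 z] fun _ => g.normSq ρ m := fun z hz hzm => by
    rw [← hzm]
    refine normSq_eventuallyEq_of_isLocalMax hQ hclosed htrace ?_
    filter_upwards [hSo.mem_nhds hz] with w hw
    rw [hzm]
    exact hmax hw
  -- By `hloc`, `S` is covered by two disjoint open sets: where `|ρ|²` is locally equal to its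
  -- maximum, and where it differs from it. The first contains `m`.
  have hall : S ⊆ {z | g.normSq ρ =ᶠ[𝓝 z] fun _ => g.normSq ρ m} := by
    refine isPreconnected_connectedComponent.subset_left_of_subset_union
      (v := {z | g.normSq ρ z ≠ g.normSq ρ m}) isOpen_setOfPred_eventually_nhds
      (isOpen_ne_fun hcont continuous_const) ?_ ?_ ⟨m, hm, hloc m hm rfl⟩
    · rw [Set.disjoint_left]
      exact fun z hz hz' => hz' hz.self_of_nhds
    · intro z hz
      by_cases h : g.normSq ρ z = g.normSq ρ m
      · exact Or.inl (hloc z hz h)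
      · exact Or.inr h
  have hx := hall mem_connectedComponent
  have hx' : g.normSq ρ x = g.normSq ρ m := hx.self_of_nhds
  rw [hx']
  exact hx

/-- At every point there is a chart, differing from a given one by a linear change, in which the
terms of the Bochner formula vanish. -/
theorem exists_rigid_linChart [CompactSpace X] [IsManifold 𝓘(ℂ, Cn n) ω X] (hQ : g.QNonneg)
    (hclosed : ρ.Closed) (htrace : g.HasConstantTrace ρ) (he : e ∈ holCharts n X) {y : Cn n}
    (hy : y ∈ e.target) : ∃ (A : Cn n ≃L[ℂ] Cn n) (lam : Fin n → ℝ),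
      g.mat (linChart e A) (A.symm y) = 1 ∧
      ρ.mat (linChart e A) (A.symm y) = diagonal (fun i => (lam i : ℂ)) ∧
      ∀ k i j, gradDefect lam (fun k => wirtMat (-Complex.I) k (g.mat (linChart e A)) (A.symm y))
          (fun k => wirtMat (-Complex.I) k (ρ.mat (linChart e A)) (A.symm y)) k i j = 0 ∧
        (lam i + lam k - lam j ≠ 0 →
          wirtMat (-Complex.I) k (g.mat (linChart e A)) (A.symm y) i j =
            wirtMat (-Complex.I) i (g.mat (linChart e A)) (A.symm y) k j) := by
  obtain ⟨A, lam, hG, hP⟩ := exists_normal_linChart g ρ he hy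
  have hy' : A (A.symm y) ∈ e.target := by rwa [A.apply_symm_apply]
  refine ⟨A, lam, hG, hP,
    (laplacian_traceSq_nonneg hQ hclosed htrace (linChart_mem he) hy' hG hP).2 ?_⟩
  -- Local constancy kills every real second derivative in the chart `e`, hence the Laplacian in the
  -- linearly changed chart, which is the equality case of `laplacian_traceSq_nonneg`.
  have h1 : (fun z => g.normSq ρ (e.symm z)) =ᶠ[𝓝 y] fun _ => g.normSq ρ (e.symm y) :=
    (e.continuousAt_symm hy).eventually (normSq_eventuallyEq hQ hclosed htrace (e.symm y))
  have h2 : (fun z => (g.traceSq ρ e z).re) =ᶠ[𝓝 y] fun _ => g.normSq ρ (e.symm y) := by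
    filter_upwards [h1, e.open_target.mem_nhds hy] with z hz hze
    rw [← g.normSq_symm ρ e he hze]
    exact hz
  have h3 : ∀ v w, fderiv ℝ (fun z => fderiv ℝ (fun z => (g.traceSq ρ e z).re) z v) y w = 0 := by
    intro v w
    have h4 : (fun z => fderiv ℝ (fun z => (g.traceSq ρ e z).re) z v) =ᶠ[𝓝 y] fun _ => 0 := by
      filter_upwards [h2.eventuallyEq_nhds] with z hz
      rw [hz.fderiv_eq]; simp
    rw [h4.fderiv_eq]; simp
  have h5 := four_mul_laplacian_linChart g ρ (A := A) he hy
    (Complex.reCLM.contDiff.comp_contDiffOn ((g.contDiffOn_traceSq ρ e he).of_le ENat.LEInfty.out))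
    fun _ _ => rfl
  simp only [Function.comp_def, Complex.reCLM_apply, h3, add_zero, Finset.sum_const_zero] at h5
  linarith

end Ellipticity

end HermitianGeometry

end

/-! ### The Bismut derivative of `ρ` and the vanishing of torsion. -/

noncomputable section

namespace HermitianGeometry

open Topology Matrix
open scoped ComplexOrder

section Conclusion

variable {n : ℕ} {X : Type*} [TopologicalSpace X] [ChartedSpace (Cn n) X]
  {g : HermitianMetric n X} {ρ : RealOneOneForm n X} {e : OpenPartialHomeomorph X (Cn n)}
  {y : Cn n}

/-- The components of `∇⁺ρ` in `(1,0)`-directions. -/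
theorem bismut_dz_eq (he : e ∈ holCharts n X) (hy : y ∈ e.target) (i k j : Fin n) :
    dz i (ρ.comp e k j) y - ∑ m, g.bismut e i k m y * ρ.comp e m j y
        - ∑ m, star (g.bismutBar e i j m y) * ρ.comp e k m y =
      bismutFst (ρ.mat e y) (g.mat e y) (fun p => wirtMat (-Complex.I) p (ρ.mat e) y)
        (fun p => wirtMat (-Complex.I) p (g.mat e) y) i k j -
      bismutSnd (ρ.mat e y) (g.mat e y) (fun p => wirtMat (-Complex.I) p (g.mat e) y) k i j := by
  set a := fun p => wirtMat (-Complex.I) p (g.mat e) y with ha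
  set P := ρ.mat e y with hP
  set K := (g.mat e y)⁻¹ with hK
  have hKh : K.IsHermitian := (g.mat_posDef e he hy).1.inv
  have h1 : ∑ m, g.bismut e i k m y * ρ.comp e m j y = (a k * (K * P)) i j := by
    simp only [HermitianMetric.bismut, g.Gam_eq]
    rw [← Matrix.mul_assoc, mul_apply]
    rfl
  have h2 : ∑ m, star (g.bismutBar e i j m y) * ρ.comp e k m y =
      (P * K * a i) k j - ∑ q, (P * K) k q * a q i j := by
    have h3 : ∀ m, star (g.bismutBar e i j m y) = ∑ q, K m q * (a i q j - a q i j) := fun m => by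
      rw [HermitianMetric.bismutBar, star_sum]
      refine Finset.sum_congr rfl fun q _ => ?_
      rw [star_mul', star_star, g.inv_eq, g.torsionLow_eq e he hy, ← hK, hKh.apply]
    rw [mul_apply, ← Finset.sum_sub_distrib]
    simp only [h3, mul_apply, Finset.sum_mul, ← Finset.sum_sub_distrib]
    rw [Finset.sum_comm]
    refine Finset.sum_congr rfl fun q _ => ?_
    refine Finset.sum_congr rfl fun m _ => ?_
    rw [show ρ.comp e k m y = P k m from rfl]
    ring
  rw [h1, h2, dz_eq_wirt, bismutFst, bismutSnd, Matrix.sub_apply, Matrix.sub_apply,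
    Matrix.sum_apply]
  simp only [Matrix.smul_apply, smul_eq_mul]
  rw [wirtMat_apply]
  change wirt (-Complex.I) i (fun z => ρ.mat e z k j) y - _ - _ = _
  ring

/-- The components of `∇⁺ρ` in `(0,1)`-directions are conjugate to those in
`(1,0)`-directions. -/
theorem bismut_dzbar_eq (he : e ∈ holCharts n X) (hy : y ∈ e.target) (i k j : Fin n) :
    dzbar i (ρ.comp e k j) y - ∑ m, g.bismutBar e i k m y * ρ.comp e m j y
        - ∑ m, star (g.bismut e i j m y) * ρ.comp e k m y =
      star (dz i (ρ.comp e j k) y - ∑ m, g.bismut e i j m y * ρ.comp e m k y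
        - ∑ m, star (g.bismutBar e i k m y) * ρ.comp e j m y) := by
  have h : ∀ z a b, star (ρ.comp e a b z) = ρ.comp e b a z := fun z a b =>
    (ρ.mat_isHermitian e z).apply b a
  have h1 : star (dz i (ρ.comp e j k) y) = dzbar i (ρ.comp e k j) y := by
    rw [dz_eq_wirt, star_wirt (f := ρ.comp e j k) (differentiableAt_of_smoothOn e.open_target
      (ρ.smoothMatOn e he j k) hy), dzbar_eq_wirt]
    simp only [h]
    simp
  rw [star_sub, star_sub, h1, star_sum, star_sum]
  simp only [star_mul', star_star, h]
  ring

theorem torsionEval_eq (he : e ∈ holCharts n X) (hy : y ∈ e.target) (u v w : Fin n → ℂ) :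
    g.torsionEval e y u v w =
      famEval (fun p => wirtMat (-Complex.I) p (g.mat e) y) u v w -
        famEval (fun p => wirtMat (-Complex.I) p (g.mat e) y) v u w := by
  have h : famEval (fun p => wirtMat (-Complex.I) p (g.mat e) y) v u w = ∑ i, ∑ j, ∑ k,
      wirtMat (-Complex.I) j (g.mat e) y i k * v j * u i * star (w k) := by
    rw [famEval_eq_sum, Finset.sum_comm]
  rw [famEval_eq_sum, h, HermitianMetric.torsionEval]
  simp only [← Finset.sum_sub_distrib, g.torsionLow_eq e he hy]
  refine Finset.sum_congr rfl fun i _ => Finset.sum_congr rfl fun j _ =>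
    Finset.sum_congr rfl fun k _ => ?_
  ring

/-- The transpose appears because the endomorphism acts on column vectors by contracting the row
index of `P`. -/
theorem endo_eq : g.endo e ρ y = (ρ.mat e y * (g.mat e y)⁻¹)ᵀ := by
  ext j i
  rw [transpose_apply, mul_apply]
  change ∑ m, g.inv e j m y * ρ.comp e i m y = _
  exact Finset.sum_congr rfl fun m _ => mul_comm _ _

variable [CompactSpace X] [IsManifold 𝓘(ℂ, Cn n) ω X]

theorem bismutParallel_of_QNonneg (hQ : g.QNonneg) (hclosed : ρ.Closed)
    (htrace : g.HasConstantTrace ρ) : g.BismutParallel ρ := by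
  have key : ∀ e ∈ holCharts n X, ∀ y ∈ e.target, ∀ i k j : Fin n,
      dz i (ρ.comp e k j) y - ∑ m, g.bismut e i k m y * ρ.comp e m j y
        - ∑ m, star (g.bismutBar e i j m y) * ρ.comp e k m y = 0 := by
    intro e he y hy i k j
    rw [bismut_dz_eq he hy, sub_eq_zero]
    obtain ⟨A, lam, hG, hP, hrig⟩ := exists_rigid_linChart hQ hclosed htrace he hy
    have hy' : A (A.symm y) ∈ e.target := by rwa [A.apply_symm_apply]
    have hM := det_linMat_ne_zero (T := A.toLinearMap) A.injective
    have ha := wirtMat_congruence A e.open_target (g.smoothMatOn e he) hy'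
      fun z hz => g.mat_linChart he hz
    have hr := wirtMat_congruence A e.open_target (ρ.smoothMatOn e he) hy'
      fun z hz => ρ.mat_linChart he hz
    have hG' := g.mat_linChart he hy'
    have hP' := ρ.mat_linChart he hy'
    rw [A.apply_symm_apply] at ha hr hG' hP'
    refine eq_swap_of_famCongr hM (fun i k j => ?_) i k j
    rw [← bismutFst_congr hM, ← bismutSnd_congr hM, ← ha, ← hr, ← hG', ← hP', hG, hP]
    obtain ⟨h1, h2⟩ := hrig i k j
    set a := fun p => wirtMat (-Complex.I) p (g.mat (linChart e A)) (A.symm y)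
    set r := fun p => wirtMat (-Complex.I) p (ρ.mat (linChart e A)) (A.symm y)
    have h3 : bismutFst (diagonal fun i => (lam i : ℂ)) 1 r a i k j =
        r i k j - lam k * a i k j := by
      simp [bismutFst]
    have h4 : bismutSnd (diagonal fun i => (lam i : ℂ)) 1 a k i j =
        a k i j * lam j - lam k * a k i j := by
      simp [bismutSnd, one_apply]
    rw [h3, h4]
    rw [gradDefect, sub_eq_zero] at h1
    rw [h1]
    -- After inserting `gradDefect = 0`, the two sides differ by `½ (λ_i + λ_k - λ_j) (a_{k i j} -
    -- a_{i k j})`. Rigidity makes one of the two factors zero.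
    by_cases h5 : lam k + lam i - lam j = 0
    · have h6 : (lam j : ℂ) = lam k + lam i := by
        rw [sub_eq_zero] at h5; exact_mod_cast h5.symm
      push_cast
      rw [h6]
      ring
    · have h6 : a i k j = a k i j := h2 h5
      push_cast
      rw [h6]
      ring
  intro e he y hy i k j
  refine ⟨key e he y hy i k j, ?_⟩
  rw [bismut_dzbar_eq he hy, key e he y hy i j k, star_zero]

/-- In the normal chart the endomorphism is diagonal, so an eigenvector has nonzero components only
at indices with the matching `λ`. Each term of the trilinear expansion then contains either a zero
component or a torsion coefficient that vanishes by rigidity. -/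
theorem torsionEval_eq_zero_of_QNonneg (hQ : g.QNonneg) (hclosed : ρ.Closed)
    (htrace : g.HasConstantTrace ρ) (he : e ∈ holCharts n X) (hy : y ∈ e.target) {a b c : ℝ}
    {u v w : Fin n → ℂ} (hu : u ∈ g.eigenspace e ρ y a) (hv : v ∈ g.eigenspace e ρ y b)
    (hw : w ∈ g.eigenspace e ρ y c) (habc : a + b - c ≠ 0) : g.torsionEval e y u v w = 0 := by
  obtain ⟨A, lam, hG, hP, hrig⟩ := exists_rigid_linChart hQ hclosed htrace he hy
  have hy' : A (A.symm y) ∈ e.target := by rwa [A.apply_symm_apply]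
  have hM := det_linMat_ne_zero (T := A.toLinearMap) A.injective
  have ha := wirtMat_congruence A e.open_target (g.smoothMatOn e he) hy'
    fun z hz => g.mat_linChart he hz
  have hG' := g.mat_linChart he hy'
  have hP' := ρ.mat_linChart he hy'
  rw [A.apply_symm_apply] at ha hG' hP'
  set M := linMat A.toLinearMap
  have hMu : IsUnit M.det := isUnit_iff_ne_zero.2 hM
  have hinv : ∀ v, M *ᵥ (M⁻¹ *ᵥ v) = v := fun v => by
    rw [mulVec_mulVec, mul_nonsing_inv _ hMu, one_mulVec]
  -- Transposing the similarity of `P G⁻¹` gives the change of basis for the endomorphism, with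
  -- `M⁻¹` converting old vector components into normal ones.
  have hend : (diagonal fun i => (lam i : ℂ)) = M⁻¹ * g.endo e ρ y * M := by
    have h1 := mul_inv_congruence (G := g.mat e y) (P := ρ.mat e y) hM
    rw [← hG', ← hP', hG, hP, inv_one, Matrix.mul_one] at h1
    have h2 := congrArg transpose h1
    rw [diagonal_transpose, transpose_mul, transpose_mul, transpose_transpose,
      transpose_nonsing_inv, transpose_transpose, ← endo_eq, ← Matrix.mul_assoc] at h2
    exact h2
  have heig : ∀ {t : ℝ} {x : Fin n → ℂ}, x ∈ g.eigenspace e ρ y t → ∀ i,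
      (M⁻¹ *ᵥ x) i ≠ 0 → lam i = t := by
    intro t x hx i hi
    have h1 : g.endo e ρ y *ᵥ x = (t : ℂ) • x := Module.End.mem_eigenspace_iff.1 hx
    have h2 : (diagonal fun i => (lam i : ℂ)) *ᵥ (M⁻¹ *ᵥ x) = (t : ℂ) • (M⁻¹ *ᵥ x) := by
      rw [hend, ← mulVec_mulVec, hinv, ← mulVec_mulVec, h1, mulVec_smul]
    have h3 := congrFun h2 i
    rw [mulVec_diagonal, Pi.smul_apply, smul_eq_mul] at h3
    exact_mod_cast mul_right_cancel₀ hi h3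
  have key : ∀ x₁ x₂ x₃, famEval (fun p => wirtMat (-Complex.I) p (g.mat e) y) x₁ x₂ x₃ =
      famEval (fun p => wirtMat (-Complex.I) p (g.mat (linChart e A)) (A.symm y))
        (M⁻¹ *ᵥ x₁) (M⁻¹ *ᵥ x₂) (M⁻¹ *ᵥ x₃) := by
    intro x₁ x₂ x₃
    rw [ha, famEval_famCongr, hinv, hinv, hinv]
  rw [torsionEval_eq he hy, key, key, sub_eq_zero, famEval_eq_sum, famEval_eq_sum, Finset.sum_comm]
  refine Finset.sum_congr rfl fun j _ => Finset.sum_congr rfl fun i _ =>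
    Finset.sum_congr rfl fun k _ => ?_
  by_cases h : lam i + lam j - lam k = 0
  · have h0 : (M⁻¹ *ᵥ u) i * (M⁻¹ *ᵥ v) j * star ((M⁻¹ *ᵥ w) k) = 0 := by
      by_contra hne
      have h1 : (M⁻¹ *ᵥ u) i ≠ 0 := fun h => hne (by rw [h]; ring)
      have h2 : (M⁻¹ *ᵥ v) j ≠ 0 := fun h => hne (by rw [h]; ring)
      have h3 : (M⁻¹ *ᵥ w) k ≠ 0 := fun h => hne (by rw [h, star_zero]; ring)
      rw [heig hu i h1, heig hv j h2, heig hw k h3] at h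
      exact habc h
    linear_combination (wirtMat (-Complex.I) i (g.mat (linChart e A)) (A.symm y) j k -
      wirtMat (-Complex.I) j (g.mat (linChart e A)) (A.symm y) i k) * h0
  · rw [(hrig j i k).2 h]
    ring

end Conclusion

end HermitianGeometry

end

open HermitianGeometry in
theorem mainTheorem3 {n : ℕ} {X : Type*} [TopologicalSpace X] [T2Space X] [CompactSpace X]
    [ChartedSpace (Cn n) X] [IsManifold 𝓘(ℂ, Cn n) ω X]
    (g : HermitianMetric n X) (hQ : g.QNonneg)
    (ρ : RealOneOneForm n X) (hclosed : ρ.Closed) (htrace : g.HasConstantTrace ρ) :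
    g.BismutParallel ρ ∧
      ∀ e ∈ holCharts n X, ∀ y ∈ e.target, ∀ (a b c : ℝ) (u v w : Fin n → ℂ),
        u ∈ g.eigenspace e ρ y a → v ∈ g.eigenspace e ρ y b → w ∈ g.eigenspace e ρ y c →
        a + b - c ≠ 0 → g.torsionEval e y u v w = 0 := by
  exact ⟨bismutParallel_of_QNonneg hQ hclosed htrace, fun _ he _ hy _ _ _ _ _ _ hu hv hw habc =>
    torsionEval_eq_zero_of_QNonneg hQ hclosed htrace he hy hu hv hw habc⟩
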